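/- Let $\ell$ be a field with algebraic closure $\overline{\ell}$, and let $A$ be an $\ell$-qurve, i.e. a finitely generated associative unital $\ell$-algebra having the lifting property modulo nilpotent two-sided ideals in the category of $\ell$-algebras (a formally smooth algebra). For $n\ge 0$ let $\ell[rep_n A]$ be the commutative $\ell$-algebra representing $C\mapsto \mathrm{Hom}_{\ell\text{-}alg}(A,M_n(C))$, and let $\pi_0(n)$ be the subalgebra of $\ell[rep_n A]$ generated by all unramified subalgebras, where a commutative $\ell$-algebra $C$ is unramified if $C\otimes\overline{\ell}\cong\overline{\ell}^{\,r}$ for some $r\geq 0$. The comorphism of the direct sum map $rep_m A\times rep_n A\to rep_{m+n}A$ is a homomorphism $s_{m,n}:\ell[rep_{m+n}A]\to\ell[rep_m A]\otimes\ell[rep_n A]$. Let $comp(A\otimes\overline{\ell})$ be the set of connected components of all the varieties of $\overline{\ell}$-points of $rep_n(A\otimes\overline{\ell})$, $n\ge 0$, with addition induced by direct sums of representations. A mock bialgebra is a bialgebra without unit map. For a monoid $G$ in which each element has finitely many decompositions as a sum, let $func(G)$ be the space of finitely supported $\overline{\ell}$-valued functions on $G$, with pointwise multiplication, comultiplication $\Delta(x_g)=\sum_{g'+g''=g}x_{g'}\otimes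 x_{g''}$ (where $x_g$ is the indicator function of $g$) and counit $f\mapsto f(0)$. Then: 1. $\pi_0(n)$ is itself unramified, so it is the maximal unramified subalgebra of $\ell[rep_n A]$. The natural map $\pi_0(m)\otimes\pi_0(n)\to\ell[rep_m A]\otimes\ell[rep_n A]$ is injective, and $s_{m,n}$ restricts to a map $\Delta_{m,n}:\pi_0(m+n)\to\pi_0(m)\otimes\pi_0(n)$. With componentwise multiplication, comultiplication $\Delta=\sum_{m+n=N}\Delta_{m,n}$ on $\pi_0(N)$, and the projection onto $\pi_0(0)=\ell$ as counit, $coco(A)=\bigoplus_{n\ge0}\pi_0(n)$ is a mock bialgebra over $\ell$. Every element of $comp(A\otimes\overline{\ell})$ has finitely many decompositions as a sum, and $func(comp(A\otimes\overline{\ell}))$ is a mock bialgebra over $\overline{\ell}$. 2. There is an isomorphism of mock bialgebras over $\overline{\ell}$ $$coco(A)\otimes\overline{\ell}\;\simeq\; func(comp(A\otimes\overline{\ell})).$$ 3. The group $\mathrm{Gal}(\overline{\ell}/\ell)=\mathrm{Aut}_\ell(\overline{\ell})$ acts on $A\otimes\overline{\ell}$, hence on $comp(A\otimes\overline{\ell})$,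 and semilinearly on functions by $(\sigma f)(\alpha)=\sigma(f(\sigma^{-1}\alpha))$. The isomorphism in 2 can be chosen such that it identifies $coco(A)=coco(A)\otimes 1$ with the set of Galois-invariant functions all of whose values are separable over $\ell$. In particular, if $\ell$ is perfect, then $$coco(A)=func(comp(A\otimes\overline{\ell}))^{\mathrm{Gal}(\overline{\ell}/\ell)}.$$ 4. $coco(A)$ determines $comp(A\otimes\overline{\ell})$: if $B$ is another $\ell$-qurve and $coco(A)\simeq coco(B)$ as mock bialgebras, then $comp(A\otimes\overline{\ell})\simeq comp(B\otimes\overline{\ell})$ as semigroups. -/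

import Mathlib

open scoped TensorProduct DirectSum

universe u v w

noncomputable section

namespace Qurve

/-! ### Qurves -/

/-- An `ℓ`-qurve (quasi-free or formally smooth algebra): a finitely generated, associative unital
`ℓ`-algebra with the lifting property modulo nilpotent two-sided ideals in the category of all
`ℓ`-algebras. -/
structure IsQurve (ℓ : Type u) (A : Type v) [Field ℓ] [Ring A] [Algebra ℓ A] : Prop where
  finiteType : Algebra.FiniteType ℓ A
  exists_lift : ∀ (B : Type (max u v)) [Ring B] [Algebra ℓ B] (I : Ideal B) [I.IsTwoSided],
    IsNilpotent I → ∀ φ : A →ₐ[ℓ] B ⧸ I,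
      ∃ ψ : A →ₐ[ℓ] B, (Ideal.Quotient.mkₐ ℓ I).comp ψ = φ

/-! ### Representation schemes -/

section RepRing

variable (ℓ : Type u) (A : Type v) [Field ℓ] [Ring A] [Algebra ℓ A]

/-- The relations saying that `a ↦ (x_{a,i,j})_{i,j}` is a homomorphism of `ℓ`-algebras. -/
inductive RepRel (n : ℕ) : MvPolynomial (A × Fin n × Fin n) ℓ → Prop
  | add (a b : A) (i j : Fin n) :
      RepRel n (.X (a + b, i, j) - (.X (a, i, j) + .X (b, i, j)))
  | mul (a b : A) (i j : Fin n) :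
      RepRel n (.X (a * b, i, j) - ∑ l, .X (a, i, l) * .X (b, l, j))
  | scalar (c : ℓ) (i j : Fin n) :
      RepRel n (.X (algebraMap ℓ A c, i, j) - if i = j then .C c else 0)

/-- The coordinate ring `ℓ[rep_n A]` of the representation scheme: the commutative `ℓ`-algebra
representing the functor `C ↦ Hom(A, M_n(C))`, see `RepRing.homEquiv`. -/
def RepRing (n : ℕ) : Type (max u v) :=
  MvPolynomial (A × Fin n × Fin n) ℓ ⧸ Ideal.span {p | RepRel ℓ A n p}

instance (n : ℕ) : CommRing (RepRing ℓ A n) :=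
  inferInstanceAs (CommRing (_ ⧸ Ideal.span {p | RepRel ℓ A n p}))

instance (n : ℕ) : Algebra ℓ (RepRing ℓ A n) :=
  inferInstanceAs (Algebra ℓ (_ ⧸ Ideal.span {p | RepRel ℓ A n p}))

namespace RepRing

variable {ℓ A} {n : ℕ}

variable (ℓ A n) in
/-- The quotient map onto the coordinate ring. -/
def mk : MvPolynomial (A × Fin n × Fin n) ℓ →ₐ[ℓ] RepRing ℓ A n :=
  Ideal.Quotient.mkₐ ℓ (Ideal.span {p | RepRel ℓ A n p})

lemma mk_surjective : Function.Surjective (mk ℓ A n) := Ideal.Quotient.mk_surjective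

lemma mk_eq_zero {p : MvPolynomial (A × Fin n × Fin n) ℓ} (h : RepRel ℓ A n p) :
    mk ℓ A n p = 0 :=
  Ideal.Quotient.eq_zero_iff_mem.2 (Ideal.subset_span h)

/-- The coordinate function `ρ ↦ ρ(a)_{ij}`. -/
def coord (a : A) (i j : Fin n) : RepRing ℓ A n := mk ℓ A n (.X (a, i, j))

variable (ℓ A n) in
/-- The universal `n`-dimensional representation. -/
def univ : A →ₐ[ℓ] Matrix (Fin n) (Fin n) (RepRing ℓ A n) :=
  have hs (c : ℓ) : (Matrix.of fun i j ↦ coord (ℓ := ℓ) (n := n) (algebraMap ℓ A c) i j) =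
      algebraMap ℓ _ c := by
    ext i j
    have := mk_eq_zero (RepRel.scalar (A := A) c i j)
    rw [map_sub, sub_eq_zero] at this
    simp only [Matrix.of_apply, coord, this, Matrix.algebraMap_matrix_apply]
    split_ifs
    · exact (mk ℓ A n).commutes c
    · simp
  have hadd (a b : A) : (Matrix.of fun i j ↦ coord (ℓ := ℓ) (n := n) (a + b) i j) =
      Matrix.of (fun i j ↦ coord a i j) + Matrix.of (fun i j ↦ coord b i j) := by
    ext i j
    have := mk_eq_zero (RepRel.add (ℓ := ℓ) a b i j)
    rw [map_sub, sub_eq_zero] at this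
    simpa [coord] using this
  { toFun a := Matrix.of fun i j ↦ coord a i j
    map_one' := by simpa using hs 1
    map_mul' a b := by
      ext i j
      have := mk_eq_zero (RepRel.mul (ℓ := ℓ) a b i j)
      rw [map_sub, sub_eq_zero] at this
      simpa [coord, Matrix.mul_apply] using this
    map_zero' := by simpa using hs 0
    map_add' := hadd
    commutes' := hs }

@[simp] lemma univ_apply (a : A) (i j : Fin n) : univ ℓ A n a i j = coord a i j := rfl

section lift

variable {C : Type w} [CommRing C] [Algebra ℓ C]

/-- The homomorphism `ℓ[rep_n A] → C` classifying a representation `A → M_n(C)`. -/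
def lift (ρ : A →ₐ[ℓ] Matrix (Fin n) (Fin n) C) : RepRing ℓ A n →ₐ[ℓ] C :=
  Ideal.Quotient.liftₐ _ (MvPolynomial.aeval fun x : A × Fin n × Fin n ↦ ρ x.1 x.2.1 x.2.2) <| by
    intro p hp
    rw [← RingHom.mem_ker]
    refine (Ideal.span_le (I := RingHom.ker
      (MvPolynomial.aeval fun x : A × Fin n × Fin n ↦ ρ x.1 x.2.1 x.2.2))).2 ?_ hp
    rintro _ (⟨a, b, i, j⟩ | ⟨a, b, i, j⟩ | ⟨c, i, j⟩)
    · simp [RingHom.mem_ker]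
    · simp [RingHom.mem_ker, Matrix.mul_apply]
    · simp only [SetLike.mem_coe, RingHom.mem_ker, map_sub, MvPolynomial.aeval_X, AlgHom.commutes,
        Matrix.algebraMap_matrix_apply]
      split_ifs <;> simp

lemma lift_mk (ρ : A →ₐ[ℓ] Matrix (Fin n) (Fin n) C) (p : MvPolynomial (A × Fin n × Fin n) ℓ) :
    lift ρ (mk ℓ A n p) = MvPolynomial.aeval (fun x ↦ ρ x.1 x.2.1 x.2.2) p := rfl

@[simp] lemma lift_coord (ρ : A →ₐ[ℓ] Matrix (Fin n) (Fin n) C) (a : A) (i j : Fin n) :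
    lift ρ (coord a i j) = ρ a i j := by
  simp [coord, lift_mk]

lemma algHom_ext {f g : RepRing ℓ A n →ₐ[ℓ] C} (h : ∀ a i j, f (coord a i j) = g (coord a i j)) :
    f = g := by
  have : f.comp (mk ℓ A n) = g.comp (mk ℓ A n) :=
    MvPolynomial.algHom_ext fun x ↦ h x.1 x.2.1 x.2.2
  ext x
  obtain ⟨p, rfl⟩ := mk_surjective x
  exact DFunLike.congr_fun this p

variable (ℓ A n C) in
/-- `ℓ[rep_n A]` represents the functor `C ↦ Hom(A, M_n(C))`. -/
def homEquiv : (A →ₐ[ℓ] Matrix (Fin n) (Fin n) C) ≃ (RepRing ℓ A n →ₐ[ℓ] C) where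
  toFun := lift
  invFun f := f.mapMatrix.comp (univ ℓ A n)
  left_inv ρ := by ext a i j; simp
  right_inv f := algHom_ext fun a i j ↦ by simp

end lift

lemma induction_on {P : RepRing ℓ A n → Prop} (f : RepRing ℓ A n)
    (hC : ∀ c : ℓ, P (algebraMap ℓ _ c)) (hadd : ∀ f g, P f → P g → P (f + g))
    (hmul : ∀ f a i j, P f → P (f * coord a i j)) : P f := by
  obtain ⟨p, rfl⟩ := mk_surjective f
  induction p using MvPolynomial.induction_on with
  | C c => exact (mk ℓ A n).commutes c ▸ hC c
  | add p q hp hq => rw [map_add]; exact hadd _ _ hp hq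
  | mul_X p x hp => rw [map_mul]; exact hmul _ _ _ _ hp

end RepRing

end RepRing

/-! ### Direct sums of representations -/

section dirSum

variable {ℓ : Type u} {A : Type v} [Field ℓ] [Ring A] [Algebra ℓ A]
  {C : Type w} [CommRing C] [Algebra ℓ C] {m n N : ℕ}

/-- The identification `{0, …, m-1} ⊔ {0, …, n-1} ≃ {0, …, N-1}` for `m + n = N`. -/
def finSumEquiv (h : m + n = N) : Fin m ⊕ Fin n ≃ Fin N := finSumFinEquiv.trans (finCongr h)

/-- The block-diagonal sum of an `m`-dimensional and an `n`-dimensional representation. -/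
def dirSum (h : m + n = N) (ρ : A →ₐ[ℓ] Matrix (Fin m) (Fin m) C)
    (σ : A →ₐ[ℓ] Matrix (Fin n) (Fin n) C) : A →ₐ[ℓ] Matrix (Fin N) (Fin N) C :=
  (Matrix.reindexAlgEquiv ℓ C (finSumEquiv h)).toAlgHom.comp
    { toFun a := Matrix.fromBlocks (ρ a) 0 0 (σ a)
      map_one' := by simp
      map_mul' a b := by simp [Matrix.fromBlocks_multiply]
      map_zero' := by simp
      map_add' a b := by simp [Matrix.fromBlocks_add]
      commutes' c := by
        ext (i | i) (j | j) <;> simp [Matrix.algebraMap_matrix_apply] }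

lemma dirSum_apply (h : m + n = N) (ρ : A →ₐ[ℓ] Matrix (Fin m) (Fin m) C)
    (σ : A →ₐ[ℓ] Matrix (Fin n) (Fin n) C) (a : A) (i j : Fin m ⊕ Fin n) :
    dirSum h ρ σ a (finSumEquiv h i) (finSumEquiv h j) =
      Matrix.fromBlocks (ρ a) 0 0 (σ a) i j := by
  simp [dirSum]

variable (ℓ A) in
/-- The zero-dimensional representation. -/
def zeroRep (C : Type w) [CommRing C] [Algebra ℓ C] : A →ₐ[ℓ] Matrix (Fin 0) (Fin 0) C where
  toFun _ := 0
  map_one' := Subsingleton.elim _ _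
  map_mul' _ _ := Subsingleton.elim _ _
  map_zero' := rfl
  map_add' _ _ := Subsingleton.elim _ _
  commutes' _ := Subsingleton.elim _ _

variable (ℓ A) in
/-- The comorphism `ℓ[rep_N A] → ℓ[rep_m A] ⊗ ℓ[rep_n A]` of the sum map
`rep_m A × rep_n A → rep_N A`, `m + n = N`. -/
def sumComap (h : m + n = N) : RepRing ℓ A N →ₐ[ℓ] RepRing ℓ A m ⊗[ℓ] RepRing ℓ A n :=
  RepRing.lift (dirSum h
    ((Algebra.TensorProduct.includeLeft (S := ℓ)).mapMatrix.comp (RepRing.univ ℓ A m))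
    (Algebra.TensorProduct.includeRight.mapMatrix.comp (RepRing.univ ℓ A n)))

end dirSum

/-! ### The component semigroup -/

section Comp

variable (k : Type u) (A : Type v) [Field k] [Ring A] [Algebra k A]

/-- The `k`-points of `rep_n A`, i.e. the `n`-dimensional representations of `A` over `k`. -/
abbrev RepPt (n : ℕ) : Type (max u v) := A →ₐ[k] Matrix (Fin n) (Fin n) k

variable {k A}

/-- The point of the prime spectrum of `k[rep_n A]` given by a `k`-point of `rep_n A`. -/
def RepPt.toPrime {n : ℕ} (ρ : RepPt k A n) : PrimeSpectrum (RepRing k A n) :=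
  PrimeSpectrum.comap (RepRing.lift ρ).toRingHom ⊥

/-- The Zariski topology on the variety of `k`-points of `rep_n A`. -/
instance (n : ℕ) : TopologicalSpace (RepPt k A n) :=
  TopologicalSpace.induced RepPt.toPrime inferInstance

lemma RepPt.isClosed_iff {n : ℕ} {Z : Set (RepPt k A n)} :
    IsClosed Z ↔ ∃ s : Set (RepRing k A n), Z = {ρ | ∀ f ∈ s, RepRing.lift ρ f = 0} := by
  rw [isClosed_induced_iff]
  have key (s : Set (RepRing k A n)) : RepPt.toPrime ⁻¹' PrimeSpectrum.zeroLocus s =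
      {ρ : RepPt k A n | ∀ f ∈ s, RepRing.lift ρ f = 0} := by
    ext ρ
    simp only [Set.mem_preimage, PrimeSpectrum.mem_zeroLocus, Set.mem_ofPred_eq]
    exact Iff.rfl
  constructor
  · rintro ⟨t, ht, rfl⟩
    obtain ⟨s, rfl⟩ := (PrimeSpectrum.isClosed_iff_zeroLocus t).1 ht
    exact ⟨s, key s⟩
  · rintro ⟨s, rfl⟩
    exact ⟨_, PrimeSpectrum.isClosed_zeroLocus s, key s⟩

lemma RepPt.continuous_of {A' : Type w} [Ring A'] [Algebra k A'] {m n : ℕ}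
    (F : RepPt k A m → RepPt k A' n)
    (hF : ∀ f : RepRing k A' n, ∃ g : RepRing k A m, ∀ ρ,
      RepRing.lift (F ρ) f = 0 ↔ RepRing.lift ρ g = 0) : Continuous F := by
  rw [continuous_iff_isClosed]
  intro Z hZ
  obtain ⟨s, rfl⟩ := RepPt.isClosed_iff.1 hZ
  choose g hg using hF
  refine RepPt.isClosed_iff.2 ⟨g '' s, ?_⟩
  ext ρ
  simp [hg]

/-- The sum map `rep_m A × rep_n A → rep_N A` on `k`-points. -/
def RepPt.sum {m n N : ℕ} (h : m + n = N) (ρ : RepPt k A m) (σ : RepPt k A n) : RepPt k A N :=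
  dirSum h ρ σ

lemma RepPt.continuous_sum_left {m n N : ℕ} (h : m + n = N) (σ : RepPt k A n) :
    Continuous fun ρ : RepPt k A m ↦ RepPt.sum h ρ σ := by
  apply RepPt.continuous_of
  suffices ∀ f : RepRing k A N, ∃ g : RepRing k A m, ∀ ρ : RepPt k A m,
      RepRing.lift (RepPt.sum h ρ σ) f = RepRing.lift ρ g by
    intro f
    obtain ⟨g, hg⟩ := this f
    exact ⟨g, fun ρ ↦ by rw [hg]⟩
  intro f
  induction f using RepRing.induction_on with
  | hC c => exact ⟨algebraMap _ _ c, fun ρ ↦ by simp⟩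
  | hadd f₁ f₂ h₁ h₂ =>
    obtain ⟨g₁, hg₁⟩ := h₁
    obtain ⟨g₂, hg₂⟩ := h₂
    exact ⟨g₁ + g₂, fun ρ ↦ by simp [hg₁, hg₂]⟩
  | hmul f₁ a i j h₁ =>
    obtain ⟨g₁, hg₁⟩ := h₁
    obtain ⟨i, rfl⟩ := (finSumEquiv h).surjective i
    obtain ⟨j, rfl⟩ := (finSumEquiv h).surjective j
    refine ⟨g₁ * Matrix.fromBlocks (Matrix.of fun i j ↦ RepRing.coord a i j) 0 0
      ((σ a).map (algebraMap k _)) i j, fun ρ ↦ ?_⟩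
    rw [map_mul, map_mul, hg₁, RepRing.lift_coord, RepPt.sum, dirSum_apply]
    congr 1
    rcases i with i | i <;> rcases j with j | j <;> simp

lemma RepPt.continuous_sum_right {m n N : ℕ} (h : m + n = N) (ρ : RepPt k A m) :
    Continuous fun σ : RepPt k A n ↦ RepPt.sum h ρ σ := by
  apply RepPt.continuous_of
  suffices ∀ f : RepRing k A N, ∃ g : RepRing k A n, ∀ σ : RepPt k A n,
      RepRing.lift (RepPt.sum h ρ σ) f = RepRing.lift σ g by
    intro f
    obtain ⟨g, hg⟩ := this f
    exact ⟨g, fun ρ ↦ by rw [hg]⟩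
  intro f
  induction f using RepRing.induction_on with
  | hC c => exact ⟨algebraMap _ _ c, fun ρ ↦ by simp⟩
  | hadd f₁ f₂ h₁ h₂ =>
    obtain ⟨g₁, hg₁⟩ := h₁
    obtain ⟨g₂, hg₂⟩ := h₂
    exact ⟨g₁ + g₂, fun ρ ↦ by simp [hg₁, hg₂]⟩
  | hmul f₁ a i j h₁ =>
    obtain ⟨g₁, hg₁⟩ := h₁
    obtain ⟨i, rfl⟩ := (finSumEquiv h).surjective i
    obtain ⟨j, rfl⟩ := (finSumEquiv h).surjective j
    refine ⟨g₁ * Matrix.fromBlocks ((ρ a).map (algebraMap k _)) 0 0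
      (Matrix.of fun i j ↦ RepRing.coord a i j) i j, fun σ ↦ ?_⟩
    rw [map_mul, map_mul, hg₁, RepRing.lift_coord, RepPt.sum, dirSum_apply]
    congr 1
    rcases i with i | i <;> rcases j with j | j <;> simp

variable (k A) in
/-- The component semigroup `comp(A)` (used for `k` algebraically closed): its elements, the
dimension vectors of `A`, are the connected components of all the varieties `rep_n A`. -/
def Comp : Type (max u v) := Σ n : ℕ, ConnectedComponents (RepPt k A n)

namespace Comp

/-- The dimension vector of a representation. -/
def of {n : ℕ} (ρ : RepPt k A n) : Comp k A := ⟨n, ConnectedComponents.mk ρ⟩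

/-- The total dimension. -/
def dim (α : Comp k A) : ℕ := α.1

/-- The sum of components: `rep_α A × rep_β A` is mapped into `rep_{α+β} A` by the sum map. -/
instance : Add (Comp k A) where
  add α β := ⟨α.1 + β.1, Quotient.map₂ (RepPt.sum rfl) (by
    intro ρ ρ' hρ σ σ' hσ
    have h₁ := (RepPt.continuous_sum_left rfl σ).image_connectedComponent_subset ρ
    have h₂ := (RepPt.continuous_sum_right rfl ρ').image_connectedComponent_subset σ
    have hρ' : connectedComponent ρ = connectedComponent ρ' := hρ
    have hσ' : connectedComponent σ = connectedComponent σ' := hσ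
    have e₁ := connectedComponent_eq (h₁ ⟨ρ', hρ' ▸ mem_connectedComponent, rfl⟩)
    have e₂ := connectedComponent_eq (h₂ ⟨σ', hσ' ▸ mem_connectedComponent, rfl⟩)
    exact e₁.trans e₂) α.2 β.2⟩

instance : Zero (Comp k A) := ⟨of (zeroRep k A k)⟩

lemma exists_of (α : Comp k A) : ∃ (n : ℕ) (ρ : RepPt k A n), α = of ρ := by
  obtain ⟨n, c⟩ := α
  obtain ⟨ρ, rfl⟩ := ConnectedComponents.surjective_coe c
  exact ⟨n, ρ, rfl⟩

lemma of_add_of {m n N : ℕ} (h : m + n = N) (ρ : RepPt k A m) (σ : RepPt k A n) :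
    of ρ + of σ = of (RepPt.sum h ρ σ) := by
  subst h; rfl

lemma of_congr {m n : ℕ} (h : m = n) (ρ : RepPt k A m) (σ : RepPt k A n)
    (e : ∀ a i j, ρ a i j = σ a (Fin.cast h i) (Fin.cast h j)) : of ρ = of σ := by
  subst h
  congr 1
  exact AlgHom.ext fun a ↦ Matrix.ext fun i j ↦ e a i j

lemma of_zero_add {n : ℕ} (ρ : RepPt k A n) : 0 + of ρ = of ρ := by
  change of (zeroRep k A k : RepPt k A 0) + of ρ = of ρ
  rw [of_add_of (Nat.zero_add n)]
  refine (of_congr rfl _ _ fun a i j ↦ ?_).symm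
  have := dirSum_apply (Nat.zero_add n) (zeroRep k A k) ρ a (.inr i) (.inr j)
  simp only [Matrix.fromBlocks_apply₂₂] at this
  rw [← this, RepPt.sum]
  have hc (i : Fin n) : finSumEquiv (Nat.zero_add n) (.inr i) = i := by
    ext; simp [finSumEquiv]
  rw [hc, hc]
  rfl

lemma of_add_zero {n : ℕ} (ρ : RepPt k A n) : of ρ + 0 = of ρ := by
  change of ρ + of (zeroRep k A k : RepPt k A 0) = of ρ
  rw [of_add_of (Nat.add_zero n)]
  refine (of_congr rfl _ _ fun a i j ↦ ?_).symm
  have := dirSum_apply (Nat.add_zero n) ρ (zeroRep k A k) a (.inl i) (.inl j)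
  simp only [Matrix.fromBlocks_apply₁₁] at this
  rw [← this, RepPt.sum]
  congr 1

lemma of_add_assoc {m n p : ℕ} (ρ : RepPt k A m) (σ : RepPt k A n) (τ : RepPt k A p) :
    of ρ + of σ + of τ = of ρ + (of σ + of τ) := by
  rw [of_add_of rfl, of_add_of rfl, of_add_of rfl, of_add_of (Nat.add_assoc m n p).symm]
  refine of_congr rfl _ _ fun a i j ↦ ?_
  have hi (x : (Fin m ⊕ Fin n) ⊕ Fin p) :
      finSumEquiv rfl (Sum.map (finSumEquiv rfl) id x) =
        finSumEquiv (Nat.add_assoc m n p).symm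
          (Sum.map id (finSumEquiv rfl) (Equiv.sumAssoc _ _ _ x)) := by
    rcases x with (x | x) | x <;> ext <;> simp [finSumEquiv, Nat.add_assoc]
  have hs : Function.Surjective fun x : (Fin m ⊕ Fin n) ⊕ Fin p ↦
      finSumEquiv (rfl : m + n + p = _) (Sum.map (finSumEquiv rfl) id x) :=
    (finSumEquiv rfl).surjective.comp
      (Sum.map_surjective.2 ⟨(finSumEquiv rfl).surjective, Function.surjective_id⟩)
  obtain ⟨x, rfl⟩ := hs i
  obtain ⟨y, rfl⟩ := hs j
  simp only [Fin.cast_refl, id]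
  conv_rhs => rw [hi, hi]
  simp only [RepPt.sum, dirSum_apply]
  rcases x with (x | x) | x <;> rcases y with (y | y) | y <;> simp [dirSum_apply]

instance : AddMonoid (Comp k A) where
  zero_add α := by obtain ⟨n, ρ, rfl⟩ := α.exists_of; exact of_zero_add ρ
  add_zero α := by obtain ⟨n, ρ, rfl⟩ := α.exists_of; exact of_add_zero ρ
  add_assoc α β γ := by
    obtain ⟨n, ρ, rfl⟩ := α.exists_of
    obtain ⟨m, σ, rfl⟩ := β.exists_of
    obtain ⟨p, τ, rfl⟩ := γ.exists_of
    exact of_add_assoc ρ σ τ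
  nsmul := nsmulRec

end Comp
end Comp

/-! ### The Galois action on the component semigroup -/

section Galois

variable {ℓ : Type u} {k : Type w} {A : Type v} [Field ℓ] [Field k] [Algebra ℓ k] [Ring A]
  [Algebra ℓ A] {n : ℕ}

/-- The representation `x ↦ σ(ρ((σ⁻¹ ⊗ 1) x))` of `k ⊗ A`. -/
def RepPt.gal (σ : k ≃ₐ[ℓ] k) (ρ : RepPt k (k ⊗[ℓ] A) n) : RepPt k (k ⊗[ℓ] A) n :=
  { σ.toAlgHom.mapMatrix.comp ((ρ.restrictScalars ℓ).comp
      (Algebra.TensorProduct.map σ.symm.toAlgHom (AlgHom.id ℓ A))) with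
    commutes' c := by
      ext i j
      have : ρ (σ.symm c ⊗ₜ[ℓ] 1) = algebraMap k _ (σ.symm c) := ρ.commutes _
      simp only [AlgHom.toRingHom_eq_coe, RingHom.coe_coe, AlgHom.comp_apply,
        AlgHom.restrictScalars_apply, Algebra.TensorProduct.algebraMap_apply,
        Algebra.algebraMap_self, RingHom.id_apply, RingHom.toMonoidHom_eq_coe,
        OneHom.toFun_eq_coe, MonoidHom.toOneHom_coe, MonoidHom.coe_coe,
        Algebra.TensorProduct.map_tmul, map_one]
      simp [this, Matrix.algebraMap_matrix_apply, apply_ite σ] }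

lemma RepPt.gal_apply (σ : k ≃ₐ[ℓ] k) (ρ : RepPt k (k ⊗[ℓ] A) n) (x : k ⊗[ℓ] A) (i j : Fin n) :
    RepPt.gal σ ρ x i j =
      σ (ρ (Algebra.TensorProduct.map σ.symm.toAlgHom (AlgHom.id ℓ A) x) i j) := rfl

lemma RepPt.continuous_gal (σ : k ≃ₐ[ℓ] k) :
    Continuous (RepPt.gal (A := A) (n := n) σ) := by
  apply RepPt.continuous_of
  suffices ∀ f : RepRing k (k ⊗[ℓ] A) n, ∃ g : RepRing k (k ⊗[ℓ] A) n,
      ∀ ρ : RepPt k (k ⊗[ℓ] A) n, RepRing.lift (RepPt.gal σ ρ) f = σ (RepRing.lift ρ g) by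
    intro f
    obtain ⟨g, hg⟩ := this f
    exact ⟨g, fun ρ ↦ by rw [hg]; simp⟩
  intro f
  induction f using RepRing.induction_on with
  | hC c => exact ⟨algebraMap _ _ (σ.symm c), fun ρ ↦ by simp⟩
  | hadd f₁ f₂ h₁ h₂ =>
    obtain ⟨g₁, hg₁⟩ := h₁
    obtain ⟨g₂, hg₂⟩ := h₂
    exact ⟨g₁ + g₂, fun ρ ↦ by simp [hg₁, hg₂]⟩
  | hmul f₁ a i j h₁ =>
    obtain ⟨g₁, hg₁⟩ := h₁
    refine ⟨g₁ * RepRing.coord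
      (Algebra.TensorProduct.map σ.symm.toAlgHom (AlgHom.id ℓ A) a) i j, fun ρ ↦ ?_⟩
    simp [hg₁, RepPt.gal_apply]

/-- The action of `Gal(k/ℓ)` on `comp(A ⊗ k)` induced by its action on `A ⊗ k`. -/
instance : SMul (k ≃ₐ[ℓ] k) (Comp k (k ⊗[ℓ] A)) where
  smul σ α := ⟨α.1, (RepPt.continuous_gal σ).connectedComponentsMap α.2⟩

lemma Comp.smul_of (σ : k ≃ₐ[ℓ] k) (ρ : RepPt k (k ⊗[ℓ] A) n) :
    σ • Comp.of ρ = Comp.of (RepPt.gal σ ρ) := rfl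

instance : MulAction (k ≃ₐ[ℓ] k) (Comp k (k ⊗[ℓ] A)) where
  one_smul α := by
    obtain ⟨n, ρ, rfl⟩ := α.exists_of
    rw [Comp.smul_of]
    refine Comp.of_congr rfl _ _ fun a i j ↦ ?_
    rw [RepPt.gal_apply]
    have : Algebra.TensorProduct.map (1 : k ≃ₐ[ℓ] k).symm.toAlgHom (AlgHom.id ℓ A) =
        AlgHom.id ℓ _ := by ext <;> simp [AlgEquiv.aut_one]
    rw [this]
    simp
  mul_smul σ τ α := by
    obtain ⟨n, ρ, rfl⟩ := α.exists_of
    simp only [Comp.smul_of]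
    refine Comp.of_congr rfl _ _ fun a i j ↦ ?_
    simp only [RepPt.gal_apply]
    have : Algebra.TensorProduct.map (σ * τ : k ≃ₐ[ℓ] k).symm.toAlgHom (AlgHom.id ℓ A) =
        (Algebra.TensorProduct.map τ.symm.toAlgHom (AlgHom.id ℓ A)).comp
          (Algebra.TensorProduct.map σ.symm.toAlgHom (AlgHom.id ℓ A)) := by
      ext x
      · change (σ * τ).symm x ⊗ₜ[ℓ] 1 = _
        simp [show (σ * τ).symm x = τ.symm (σ.symm x) from rfl]
      · simp
    rw [this]
    simp

end Galois

/-! ### Mock bialgebras -/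

/-- A mock bialgebra: a bialgebra without a unit map, i.e. a coassociative counital coalgebra which
is also a (not necessarily unital) algebra such that comultiplication and counit are
multiplicative. -/
structure IsMockBialgebra (k : Type u) (B : Type v) [Field k] [NonUnitalRing B] [Module k B]
    [IsScalarTower k B B] [SMulCommClass k B B] [CoalgebraStruct k B] : Prop where
  coassoc : TensorProduct.assoc k B B B ∘ₗ CoalgebraStruct.comul.rTensor B ∘ₗ
    CoalgebraStruct.comul = CoalgebraStruct.comul.lTensor B ∘ₗ CoalgebraStruct.comul (R := k)
  rTensor_counit_comp_comul : CoalgebraStruct.counit.rTensor B ∘ₗ CoalgebraStruct.comul =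
    TensorProduct.mk k k B 1
  lTensor_counit_comp_comul : CoalgebraStruct.counit.lTensor B ∘ₗ CoalgebraStruct.comul =
    (TensorProduct.mk k B k).flip 1
  comul_mul (x y : B) : CoalgebraStruct.comul (R := k) (x * y) =
    CoalgebraStruct.comul (R := k) x * CoalgebraStruct.comul (R := k) y
  counit_mul (x y : B) : CoalgebraStruct.counit (R := k) (x * y) =
    CoalgebraStruct.counit (R := k) x * CoalgebraStruct.counit (R := k) y

/-! ### The function mock bialgebra -/

section Func

variable (k : Type u) (G : Type v) [Field k]

/-- The underlying space of `func(G)`: the `k`-valued functions on `G` of finite support, i.e. the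
span of the functions `x_g`, where `x_g` is `1` at `g` and `0` elsewhere. -/
def Func : Type (max u v) := G →₀ k

/-- Pointwise addition and multiplication. -/
instance : NonUnitalCommRing (Func k G) := inferInstanceAs (NonUnitalCommRing (G →₀ k))

instance : Module k (Func k G) := inferInstanceAs (Module k (G →₀ k))

instance : FunLike (Func k G) G k := inferInstanceAs (FunLike (G →₀ k) G k)

lemma Func.mul_apply (f₁ f₂ : Func k G) (g : G) : (f₁ * f₂) g = f₁ g * f₂ g := rfl

instance : IsScalarTower k (Func k G) (Func k G) :=
  ⟨fun a x y ↦ DFunLike.ext (F := G →₀ k) _ _ fun g ↦ mul_assoc a (x g) (y g)⟩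

instance : SMulCommClass k (Func k G) (Func k G) :=
  ⟨fun a x y ↦ DFunLike.ext (F := G →₀ k) _ _ fun g ↦ mul_left_comm a (x g) (y g)⟩

variable {G} in
/-- The function `x_g`. -/
def Func.x (g : G) : Func k G := Finsupp.single g 1

/-- `Δ(x_g) = ∑_{g' + g'' = g} x_{g'} ⊗ x_{g''}` (for monoids in which every element has finitely
many decompositions `g = g' + g''`), and the counit is the evaluation at the neutral element. -/
instance [AddMonoid G] : CoalgebraStruct k (Func k G) where
  comul := Finsupp.linearCombination k fun g : G ↦
    ∑ᶠ p : {p : G × G // p.1 + p.2 = g}, Func.x k p.1.1 ⊗ₜ[k] Func.x k p.1.2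
  counit := Finsupp.lapply (0 : G)

/-- The semilinear action of `Gal(k/ℓ)` on the functions on a set with an action of this group:
`(σ f)(g) = σ(f(σ⁻¹ g))`. -/
def Func.gal {k G} [Field k] {ℓ : Type w} [Field ℓ] [Algebra ℓ k] [MulAction (k ≃ₐ[ℓ] k) G]
    (σ : k ≃ₐ[ℓ] k) (f : Func k G) : Func k G :=
  (Finsupp.equivMapDomain (MulAction.toPerm σ) f).mapRange σ (map_zero σ)

lemma Func.gal_apply {k G} [Field k] {ℓ : Type w} [Field ℓ] [Algebra ℓ k]
    [MulAction (k ≃ₐ[ℓ] k) G] (σ : k ≃ₐ[ℓ] k) (f : Func k G) (g : G) :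
    Func.gal σ f g = σ (f (σ⁻¹ • g)) := rfl

end Func

/-! ### The component coalgebra -/

section Coco

/-- A commutative `ℓ`-algebra is unramified if it becomes a finite product of copies of the
algebraic closure after base change to the algebraic closure. -/
def IsUnramified (ℓ : Type u) (C : Type v) [Field ℓ] [CommRing C] [Algebra ℓ C] : Prop :=
  ∃ r : ℕ, Nonempty (AlgebraicClosure ℓ ⊗[ℓ] C ≃ₐ[AlgebraicClosure ℓ] (Fin r → AlgebraicClosure ℓ))

/-- `π₀(C)`: the maximal unramified subalgebra, i.e. the subalgebra generated by all unramified
subalgebras. -/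
def piZero (ℓ : Type u) (C : Type v) [Field ℓ] [CommRing C] [Algebra ℓ C] : Subalgebra ℓ C :=
  sSup {S | IsUnramified ℓ S}

variable (ℓ : Type u) (A : Type v) [Field ℓ] [Ring A] [Algebra ℓ A]

/-- `π₀(n) = π₀(ℓ[rep_n A])`. -/
abbrev piRep (n : ℕ) : Subalgebra ℓ (RepRing ℓ A n) := piZero ℓ (RepRing ℓ A n)

/-- The (injective) natural map `π₀(m) ⊗ π₀(n) → ℓ[rep_m A] ⊗ ℓ[rep_n A]`. -/
def piRepIncl (m n : ℕ) : piRep ℓ A m ⊗[ℓ] piRep ℓ A n →ₐ[ℓ] RepRing ℓ A m ⊗[ℓ] RepRing ℓ A n :=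
  Algebra.TensorProduct.map (piRep ℓ A m).val (piRep ℓ A n).val

/-- The map `Δ_{m,n} : π₀(N) → π₀(m) ⊗ π₀(n)`, `m + n = N`, determined by the sum map
`rep_m A × rep_n A → rep_N A`. The comorphism of the sum map sends `π₀(N)` into the image of the
injective map `piRepIncl`; here the inverse of the latter on its image is taken as a linear left
inverse. -/
def piRepComul {m n N : ℕ} (h : m + n = N) :
    piRep ℓ A N →ₗ[ℓ] piRep ℓ A m ⊗[ℓ] piRep ℓ A n :=
  (piRepIncl ℓ A m n).toLinearMap.leftInverse ∘ₗ (sumComap ℓ A h).toLinearMap ∘ₗ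
    (piRep ℓ A N).val.toLinearMap

/-- The graded vector space `coco(A) = π₀(0) ⊕ π₀(1) ⊕ π₀(2) ⊕ ⋯`. -/
def Coco : Type (max u v) := ⨁ n, piRep ℓ A n

instance : AddCommGroup (Coco ℓ A) := inferInstanceAs (AddCommGroup (⨁ n, piRep ℓ A n))

instance : Module ℓ (Coco ℓ A) := inferInstanceAs (Module ℓ (⨁ n, piRep ℓ A n))

namespace Coco

/-- The inclusion of `π₀(n)`. -/
def of (n : ℕ) : piRep ℓ A n →ₗ[ℓ] Coco ℓ A :=
  DirectSum.lof ℓ ℕ (fun n ↦ piRep ℓ A n) n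

/-- The projection to `π₀(n)`. -/
def proj (n : ℕ) : Coco ℓ A →ₗ[ℓ] piRep ℓ A n :=
  DirectSum.component ℓ ℕ (fun n ↦ piRep ℓ A n) n

variable {ℓ A} in
lemma ext {x y : Coco ℓ A} (h : ∀ n, proj ℓ A n x = proj ℓ A n y) : x = y := DirectSum.ext_component ℓ h

/-- The multiplication of the direct sum of the algebras `π₀(n)` (componentwise). -/
instance : Mul (Coco ℓ A) :=
  ⟨DFinsupp.zipWith (fun _ a b ↦ a * b) fun _ ↦ mul_zero 0⟩

variable {ℓ A} in
lemma proj_mul (n : ℕ) (x y : Coco ℓ A) :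
    proj ℓ A n (x * y) = proj ℓ A n x * proj ℓ A n y := rfl

instance : NonUnitalCommRing (Coco ℓ A) where
  left_distrib x y z := ext fun n ↦ by simp [proj_mul, mul_add]
  right_distrib x y z := ext fun n ↦ by simp [proj_mul, add_mul]
  zero_mul x := ext fun n ↦ by simp [proj_mul]
  mul_zero x := ext fun n ↦ by simp [proj_mul]
  mul_assoc x y z := ext fun n ↦ by simp [proj_mul, mul_assoc]
  mul_comm x y := ext fun n ↦ by simp [proj_mul, mul_comm]

instance : IsScalarTower ℓ (Coco ℓ A) (Coco ℓ A) :=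
  ⟨fun c x y ↦ ext fun n ↦ by simp [proj_mul]⟩

instance : SMulCommClass ℓ (Coco ℓ A) (Coco ℓ A) :=
  ⟨fun c x y ↦ ext fun n ↦ by simp [proj_mul]⟩

/-- The comultiplication `∑_{m + n = N} Δ_{m,n}` on `π₀(N)`; the counit is the projection to
`π₀(0)`, identified with `ℓ` by evaluation at the unique point of `rep_0 A`. -/
instance : CoalgebraStruct ℓ (Coco ℓ A) where
  comul := DirectSum.toModule ℓ ℕ _ fun N ↦ ∑ p : Finset.HasAntidiagonal.antidiagonal N,
    TensorProduct.map (of ℓ A p.1.1) (of ℓ A p.1.2) ∘ₗ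
      piRepComul ℓ A (Finset.HasAntidiagonal.mem_antidiagonal.1 p.2)
  counit := (RepRing.lift (zeroRep ℓ A ℓ)).toLinearMap ∘ₗ (piRep ℓ A 0).val.toLinearMap ∘ₗ
    proj ℓ A 0

end Coco
end Coco

end Qurve

/-! Write `C` for `ℓ[rep_n A]` and `K` for an algebraic closure of `ℓ`. Lifting representations
along `M_n(B) → M_n(B/I)` shows that `C` is formally smooth; it is finitely generated, hence smooth.
So `K ⊗ C` is reduced, also for imperfect `ℓ`, and by the Nullstellensatz its elements are
determined by their values at `K`-points, that is, at the `n`-dimensional representations of `K ⊗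
A`.

Algebra and topology meet in `finiteValues`. A finite-valued function has closed fibers, so it is
constant on connected components, and `K ⊗ finiteValues` embeds into the functions on the finite set
of components. This embedding is onto: the indicator of a component is an idempotent `e` of `K ⊗ C`.
Since `e = e ^ q ^ n`, it is defined over a finite separable extension `F` of `ℓ`. Its coordinates
in a basis of `F` are recovered from the conjugates of `e`, which only take the values `0` and `1`,
by inverting the matrix of embeddings; so these coordinates are finite-valued. Hence `finiteValues`
is unramified. It contains every unramified subalgebra, whose elements are integral, so it is
`π₀(n)`, and `K ⊗ π₀(n)` is the algebra of functions on the components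
(`IsDecomposition.values_bijective`, `piRepValues`).

The rest is tested on characters. Each component `g` gives a multiplicative functional `χ_g`
(`Coco.char`). The `χ_g` are jointly injective even after base change, and so are their tensor
products (`Separates.tmul`). Moreover `(χ_g ⊗ χ_h) ∘ Δ = χ_{g+h}` and the counit is `χ_0`. The mock
bialgebra axioms thus become the monoid axioms of `comp`, and `z ↦ (g ↦ χ_g(z))` is the isomorphism
with `func(comp)`. Since `χ_{σg} = σ ∘ χ_g` and all values are separable, linear Galois descent
identifies `coco(A)`. Finally, the `χ_g` are exactly the nonzero multiplicative functionals `coco(A)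
→ K` (`Coco.exists_char_eq`) and convolution of them is addition of components, so `coco(A)`
determines `comp`. -/

namespace Qurve

/-! ### Smooth algebras over a field are reduced -/

section Reduced

open Polynomial in
/-- A smooth algebra over a field is reduced: formation of the integral closure of `k` in `k[X]`
commutes with smooth base change, so that `s ⊗ X` is integral over `S` only if `s = 0`. -/
lemma isReduced_of_smooth (k : Type u) (S : Type v) [Field k] [CommRing S] [Algebra k S]
    [Algebra.Smooth k S] : IsReduced S := by
  refine ⟨fun s hs ↦ ?_⟩
  have hint : IsIntegral S (s ⊗ₜ[k] (X : k[X])) := by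
    obtain ⟨n, hn⟩ := hs
    refine IsIntegral.of_pow (n := n + 1) n.succ_pos ?_
    rw [Algebra.TensorProduct.tmul_pow, pow_succ, hn, zero_mul, TensorProduct.zero_tmul]
    exact isIntegral_zero
  obtain ⟨y, hy⟩ := (TensorProduct.toIntegralClosure_bijective_of_smooth (R := k) (S := S)
    (B := k[X])).2 ⟨_, hint⟩
  -- A monic `f` with `f(p) = 0` forces `deg f * deg p = 0`, so `p` is constant.
  have hC (p : integralClosure k k[X]) : (p : k[X]).coeff 1 = 0 := by
    have hp : IsIntegral k (p : k[X]) := p.2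
    obtain ⟨f, hf, hf0⟩ := hp
    have h0 : f.comp (p : k[X]) = 0 := by simpa [Polynomial.comp] using hf0
    have hd : (p : k[X]).natDegree = 0 := by
      by_contra h
      have hn := congrArg natDegree h0
      rw [natDegree_comp, natDegree_zero, mul_eq_zero, or_iff_left h] at hn
      have h1 : f = 1 := hf.natDegree_eq_zero.1 hn
      simp [h1] at h0
    exact coeff_eq_zero_of_natDegree_lt (by omega)
  -- Reading off the coefficient of `X` kills everything coming from constants, but sends `s ⊗ X` to
  -- `s`.
  have key : ∀ y : S ⊗[k] integralClosure k k[X], (lcoeff k 1).lTensor S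
      (TensorProduct.toIntegralClosure k S k[X] y : S ⊗[k] k[X]) = 0 := by
    intro y
    induction y with
    | zero => simp
    | add a b ha hb => simp [ha, hb]
    | tmul a b => simp [TensorProduct.toIntegralClosure, hC]
  have := key y
  rw [hy] at this
  simpa using congrArg (TensorProduct.rid k S) this

end Reduced

/-! ### Nullstellensatz for finitely generated algebras -/

section Nullstellensatz

variable {K : Type u} {D : Type v} [Field K] [IsAlgClosed K] [CommRing D] [Algebra K D]
  [Algebra.FiniteType K D]

/-- The residue field is finite over `K` by Zariski's lemma, hence equal to `K`. -/
lemma exists_algHom_ker_eq (m : Ideal D) [m.IsMaximal] : ∃ f : D →ₐ[K] K, ∀ x, f x = 0 ↔ x ∈ m := by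
  let _ : Field (D ⧸ m) := Ideal.Quotient.field m
  have : Module.Finite K (D ⧸ m) := finite_of_finite_type_of_isJacobsonRing K (D ⧸ m)
  have hb : Function.Bijective (Algebra.ofId K (D ⧸ m)) :=
    IsAlgClosed.algebraMap_bijective_of_isIntegral
  refine ⟨((AlgEquiv.ofBijective _ hb).symm : (D ⧸ m) →ₐ[K] K).comp (Ideal.Quotient.mkₐ K m),
    fun x ↦ ?_⟩
  simp [Ideal.Quotient.eq_zero_iff_mem]

lemma exists_algHom_of_ne_top {I : Ideal D} (hI : I ≠ ⊤) : ∃ f : D →ₐ[K] K, ∀ x ∈ I, f x = 0 := by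
  obtain ⟨m, hm, hIm⟩ := I.exists_le_maximal hI
  obtain ⟨f, hf⟩ := exists_algHom_ker_eq (K := K) m
  exact ⟨f, fun x hx ↦ (hf x).2 (hIm hx)⟩

-- `D` is a Jacobson ring, so its zero ideal, being radical, is the intersection of the maximal
-- ideals, each of which is the kernel of a `K`-point.
variable (K) in
lemma eq_zero_of_forall_algHom [IsReduced D] {x : D} (hx : ∀ f : D →ₐ[K] K, f x = 0) : x = 0 := by
  have : IsJacobsonRing D := isJacobsonRing_of_finiteType (A := K)
  have h : x ∈ (⊥ : Ideal D).jacobson := by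
    rw [Ideal.jacobson, Submodule.mem_sInf]
    rintro m ⟨-, hm⟩
    obtain ⟨f, hf⟩ := exists_algHom_ker_eq (K := K) m
    exact (hf x).1 (hx f)
  have hr : (⊥ : Ideal D).IsRadical := fun x hx ↦ by
    obtain ⟨n, hn⟩ := hx
    exact eq_zero_of_pow_eq_zero hn
  rwa [IsJacobsonRing.out inferInstance hr, Ideal.mem_bot] at h

end Nullstellensatz

/-! ### Connected components of Noetherian spaces -/

section Topology

open TopologicalSpace

variable {X : Type u} [TopologicalSpace X]

/-- Every connected component contains an irreducible component, and a Noetherian space has finitely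
many of those. -/
lemma finite_connectedComponents [NoetherianSpace X] : Finite (ConnectedComponents X) := by
  have := (NoetherianSpace.finite_irreducibleComponents (α := X)).to_subtype
  choose g hg using fun Z : irreducibleComponents X ↦ Z.2.1.1
  refine Finite.of_surjective (fun Z ↦ (ConnectedComponents.mk (g Z) : ConnectedComponents X)) ?_
  intro y
  obtain ⟨x, rfl⟩ := ConnectedComponents.surjective_coe y
  refine ⟨⟨irreducibleComponent x, irreducibleComponent_mem_irreducibleComponents x⟩, ?_⟩
  refine ConnectedComponents.coe_eq_coe'.2 ?_
  exact isIrreducible_irreducibleComponent.isConnected.isPreconnected.subset_connectedComponent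
    mem_irreducibleComponent (hg ⟨_, irreducibleComponent_mem_irreducibleComponents x⟩)

lemma isClopen_connectedComponents_fiber [Finite (ConnectedComponents X)]
    (y : ConnectedComponents X) : IsClopen {x : X | (x : ConnectedComponents X) = y} :=
  (isClopen_discrete {y}).preimage ConnectedComponents.continuous_coe

/-- A function with finite range and closed fibers is constant on connected components. -/
lemma eq_of_connectedComponents_eq {Z : Type v} {f : X → Z} (hf : (Set.range f).Finite)
    (hc : ∀ z, IsClosed (f ⁻¹' {z})) {x y : X}
    (h : (x : ConnectedComponents X) = y) : f x = f y := by
  have ho : IsClopen (f ⁻¹' {f x}) := by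
    refine ⟨hc _, ?_⟩
    rw [← isClosed_compl_iff]
    have : (f ⁻¹' {f x})ᶜ = ⋃ z ∈ Set.range f \ {f x}, f ⁻¹' {z} := by
      ext a; simp
    rw [this]
    exact (hf.subset Set.sdiff_subset).isClosed_biUnion fun z _ ↦ hc z
  have := ho.connectedComponent_subset (x := x) rfl
  exact (this (ConnectedComponents.coe_eq_coe'.1 h.symm)).symm

end Topology

/-! ### Separating families of functionals -/

section Separates

variable {ℓ K : Type*} [Field ℓ] [Field K] [Algebra ℓ K]
  {V : Type*} [AddCommGroup V] [Module ℓ V] {W : Type*} [AddCommGroup W] [Module ℓ W]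
  {ι κ : Type*}

/-- A family of `ℓ`-linear maps `V → K` separates `V` if its `K`-linear extensions are jointly
injective on `K ⊗ V`. -/
def Separates (χ : ι → V →ₗ[ℓ] K) : Prop :=
  ∀ x : K ⊗[ℓ] V, (∀ i, (χ i).liftBaseChange K x = 0) → x = 0

/-- The map `v ⊗ w ↦ χ(v)ψ(w)`. -/
def tmulFun (χ : V →ₗ[ℓ] K) (ψ : W →ₗ[ℓ] K) : V ⊗[ℓ] W →ₗ[ℓ] K :=
  LinearMap.mul' ℓ K ∘ₗ TensorProduct.map χ ψ

@[simp] lemma tmulFun_tmul (χ : V →ₗ[ℓ] K) (ψ : W →ₗ[ℓ] K) (v : V) (w : W) :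
    tmulFun χ ψ (v ⊗ₜ w) = χ v * ψ w := rfl

lemma Separates.eq_zero {χ : ι → V →ₗ[ℓ] K} (h : Separates χ) {v : V} (hv : ∀ i, χ i v = 0) :
    v = 0 := by
  have := h (1 ⊗ₜ v) fun i ↦ by simp [hv]
  have hi : Function.Injective (TensorProduct.mk ℓ K V 1) := by
    exact Module.FaithfullyFlat.tensorProduct_mk_injective V
  exact hi (by simpa using this)

lemma Separates.ext {χ : ι → V →ₗ[ℓ] K} (h : Separates χ) {v v' : V}
    (hv : ∀ i, χ i v = χ i v') : v = v' :=
  sub_eq_zero.1 (h.eq_zero fun i ↦ by simp [hv])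

lemma separates_of_eq_zero {V : Type*} [AddCommGroup V] [Module K V] {χ : ι → V →ₗ[K] K}
    (h : ∀ v, (∀ i, χ i v = 0) → v = 0) : Separates χ := by
  intro x hx
  apply (TensorProduct.lid K V).injective
  rw [map_zero]
  refine h _ fun i ↦ ?_
  rw [← hx i]
  generalize x = x
  induction x with
  | zero => simp
  | add a b ha hb => simp only [map_add, ha, hb]
  | tmul a b => simp

/-- Joint injectivity of the maps `χ ⊗ ψ` on the tensor product of a `K`-space and an `ℓ`-space. -/
lemma Separates.eq_zero_of_tmul {U : Type*} [AddCommGroup U] [Module K U] [Module ℓ U]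
    [IsScalarTower ℓ K U] {χ : ι → U →ₗ[K] K} (hχ : ∀ v, (∀ i, χ i v = 0) → v = 0)
    {ψ : κ → W →ₗ[ℓ] K} (hψ : Separates ψ) (x : U ⊗[ℓ] W)
    (hx : ∀ i j, tmulFun ((χ i).restrictScalars ℓ) (ψ j) x = 0) : x = 0 := by
  -- The two factors are removed one at a time: `ψ` kills `(χ i ⊗ 1) x` in `K ⊗ W`, and then `χ`
  -- kills each coordinate of `x` in a basis of `W`.
  have h₁ (i : ι) : ((χ i).restrictScalars ℓ).rTensor W x = 0 := by
    refine hψ _ fun j ↦ ?_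
    rw [← hx i j]
    generalize x = x
    induction x with
    | zero => simp
    | add a b ha hb => rw [map_add, map_add, map_add, ha, hb]
    | tmul a b => simp
  classical
  let b := Module.Basis.ofVectorSpace ℓ W
  apply (TensorProduct.equivFinsuppOfBasisRight (M := U) b).injective
  ext j
  rw [map_zero, Finsupp.zero_apply]
  refine hχ _ fun i ↦ ?_
  have h₂ := DFunLike.congr_fun (congrArg (TensorProduct.equivFinsuppOfBasisRight (M := K) b) (h₁ i)) j
  simp only [map_zero, Finsupp.coe_zero, Pi.zero_apply] at h₂ ⊢
  rw [← h₂]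
  generalize x = x
  induction x with
  | zero => simp
  | add a b ha hb => simp only [map_add, Finsupp.add_apply, ha, hb]
  | tmul a b => simp [TensorProduct.equivFinsuppOfBasisRight_apply_tmul]

/-- Reassociate to `(K ⊗ V) ⊗ W`: the first factor is a `K`-space on which the extended `χ` are
jointly injective. -/
lemma Separates.tmul {χ : ι → V →ₗ[ℓ] K} {ψ : κ → W →ₗ[ℓ] K} (hχ : Separates χ)
    (hψ : Separates ψ) : Separates fun p : ι × κ ↦ tmulFun (χ p.1) (ψ p.2) := by
  intro x hx
  apply (TensorProduct.assoc ℓ K V W).symm.injective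
  rw [map_zero]
  refine Separates.eq_zero_of_tmul (χ := fun i ↦ (χ i).liftBaseChange K) hχ hψ _ fun i j ↦ ?_
  rw [← hx (i, j)]
  generalize x = x
  induction x with
  | zero => simp
  | add a b ha hb => simp only [map_add, ha, hb]
  | tmul a b =>
    induction b with
    | zero => simp
    | add a b ha hb => simp only [TensorProduct.tmul_add, map_add, ha, hb]
    | tmul a b => simp [mul_assoc]

end Separates

/-! ### Finite-valued functions and idempotents -/

section FiniteValues

variable (ℓ K C : Type*) [Field ℓ] [Field K] [Algebra ℓ K] [CommRing C] [Algebra ℓ C]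

/-- The subalgebra of all elements taking only finitely many values at `K`-points. -/
def finiteValues : Subalgebra ℓ C where
  carrier := {c | (Set.range fun ρ : C →ₐ[ℓ] K ↦ ρ c).Finite}
  mul_mem' {a b} ha hb := (ha.image2 (· * ·) hb).subset <| by
    rintro _ ⟨ρ, rfl⟩
    exact ⟨ρ a, ⟨ρ, rfl⟩, ρ b, ⟨ρ, rfl⟩, (map_mul ρ a b).symm⟩
  add_mem' {a b} ha hb := (ha.image2 (· + ·) hb).subset <| by
    rintro _ ⟨ρ, rfl⟩
    exact ⟨ρ a, ⟨ρ, rfl⟩, ρ b, ⟨ρ, rfl⟩, (map_add ρ a b).symm⟩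
  algebraMap_mem' c := (Set.finite_singleton (algebraMap ℓ K c)).subset <| by
    rintro _ ⟨ρ, rfl⟩
    simp

variable {ℓ K C}

/-- All values are roots of one monic polynomial annihilating `c`. -/
lemma mem_finiteValues_of_isIntegral {c : C} (hc : IsIntegral ℓ c) : c ∈ finiteValues ℓ K C := by
  classical
  obtain ⟨p, hp, hp0⟩ := hc
  refine ((p.map (algebraMap ℓ K)).roots.toFinset.finite_toSet).subset ?_
  rintro _ ⟨ρ, rfl⟩
  have h0 : (p.map (algebraMap ℓ K)) ≠ 0 := (hp.map _).ne_zero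
  have := congrArg ρ hp0
  rw [← Polynomial.aeval_def, ← Polynomial.aeval_algHom_apply, map_zero] at this
  simpa [h0] using this

variable (K) in
/-- A family whose values against all embeddings of a finite separable extension are `0` or `1`
takes finitely many values. -/
lemma finite_range_of_embeddings [IsAlgClosed K] {F : Type*} [Field F] [Algebra ℓ F]
    [FiniteDimensional ℓ F] [Algebra.IsSeparable ℓ F] {ι : Type*} [Fintype ι] [DecidableEq ι]
    (b : Module.Basis ι ℓ F) {X : Type*} (d : X → ι → K)
    (h : ∀ x (τ : F →ₐ[ℓ] K), ∑ j, τ (b j) * d x j = 0 ∨ ∑ j, τ (b j) * d x j = 1) :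
    (Set.range d).Finite := by
  have hcard : Fintype.card ι = Fintype.card (F →ₐ[ℓ] K) := by
    rw [AlgHom.card, Module.finrank_eq_card_basis b]
  let ε : ι ≃ (F →ₐ[ℓ] K) := Fintype.equivOfCardEq hcard
  let M := Algebra.embeddingsMatrixReindex ℓ K b ε
  -- The matrix `(τ(b_j))` is square because `F` has as many embeddings as its degree. The square of
  -- its determinant is the discriminant, nonzero by separability. So `d x` is determined by a
  -- vector with entries in `{0, 1}`.
  have hM : IsUnit M := by
    rw [Matrix.isUnit_iff_isUnit_det, isUnit_iff_ne_zero]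
    intro h0
    have h1 := Algebra.discr_eq_det_embeddingsMatrixReindex_pow_two ℓ K b ε
    rw [show (Algebra.embeddingsMatrixReindex ℓ K b ε).det = 0 from h0] at h1
    exact Algebra.discr_not_zero_of_basis ℓ b (by simpa using h1)
  have hinj : Function.Injective fun v : ι → K ↦ Matrix.vecMul v M :=
    Matrix.vecMul_injective_of_isUnit hM
  have hfin : (Set.univ.pi fun _ : ι ↦ ({0, 1} : Set K)).Finite :=
    Set.Finite.pi fun _ ↦ Set.toFinite _
  refine (hfin.preimage hinj.injOn).subset ?_
  rintro _ ⟨x, rfl⟩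
  simp only [Set.mem_preimage, Set.mem_pi, Set.mem_univ, forall_true_left]
  intro i
  have : Matrix.vecMul (d x) M i = ∑ j, ε i (b j) * d x j := by
    simp [Matrix.vecMul, dotProduct, M, Algebra.embeddingsMatrixReindex, mul_comm]
  rw [this]
  simpa using h x (ε i)

variable [Algebra.IsAlgebraic ℓ K]

/-- `K` is purely inseparable over the separable closure of `ℓ`, so each element has a separable
`q`-power power; adding exponents serves finitely many elements at once. -/
lemma exists_pow_isSeparable (q : ℕ) [ExpChar ℓ q] (S : Finset K) :
    ∃ n, ∀ x ∈ S, IsSeparable ℓ (x ^ q ^ n) := by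
  classical
  induction S using Finset.induction_on with
  | empty => exact ⟨0, by simp⟩
  | insert a S ha ih =>
    obtain ⟨n, hn⟩ := ih
    obtain ⟨m, y, hy⟩ := IsPurelyInseparable.pow_mem (separableClosure ℓ K) q a
    have hm : IsSeparable ℓ (a ^ q ^ m) := by
      rw [← hy]; exact mem_separableClosure_iff.1 y.2
    refine ⟨m + n, fun x hx ↦ ?_⟩
    rcases Finset.mem_insert.1 hx with rfl | hx
    · rw [pow_add, pow_mul]
      exact mem_separableClosure_iff.1 (pow_mem (mem_separableClosure_iff.2 hm) _)
    · rw [pow_add, mul_comm, pow_mul]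
      exact mem_separableClosure_iff.1 (pow_mem (mem_separableClosure_iff.2 (hn x hx)) _)

/-- Write `e = ∑ a ⊗ c`. As Frobenius is additive, `e = e ^ q ^ n = ∑ a ^ q ^ n ⊗ c ^ q ^ n`, and
for large `n` the coefficients `a ^ q ^ n` are separable; they generate `F`. -/
lemma exists_finite_separable_of_idempotent {e : K ⊗[ℓ] C} (he : e * e = e) :
    ∃ F : IntermediateField ℓ K, FiniteDimensional ℓ F ∧ Algebra.IsSeparable ℓ F ∧
      ∃ z : F ⊗[ℓ] C, Algebra.TensorProduct.map F.val (AlgHom.id ℓ C) z = e := by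
  classical
  rcases subsingleton_or_nontrivial (K ⊗[ℓ] C) with _ | _
  · exact ⟨⊥, inferInstance, inferInstance, 0, Subsingleton.elim _ _⟩
  obtain ⟨q, hq⟩ := ExpChar.exists ℓ
  obtain ⟨S, hS⟩ := TensorProduct.exists_finset e
  obtain ⟨n, hn⟩ := exists_pow_isSeparable (ℓ := ℓ) q (S.image Prod.fst)
  have hpow : e ^ q ^ n = e := by
    have hid : IsIdempotentElem e := he
    exact hid.pow_eq (pow_ne_zero _ (expChar_ne_zero ℓ q))
  let T : Set K := ↑((S.image Prod.fst).image (· ^ q ^ n))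
  let F := IntermediateField.adjoin ℓ T
  have hT : ∀ x ∈ T, IsSeparable ℓ x := by
    intro x hx
    simp only [T, Finset.coe_image, Set.mem_image] at hx
    obtain ⟨y, hy, rfl⟩ := hx
    exact hn y (by simpa using hy)
  have h1 : Algebra.IsSeparable ℓ F :=
    (IntermediateField.isSeparable_adjoin_iff_isSeparable ℓ K).2 hT
  have h2 : FiniteDimensional ℓ F := by
    have : Finite T := Finset.finite_toSet _
    exact IntermediateField.finiteDimensional_adjoin fun x hx ↦ (hT x hx).isIntegral
  have hmem (p : K × C) (hp : p ∈ S) : p.1 ^ q ^ n ∈ F := by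
    refine IntermediateField.subset_adjoin _ _ ?_
    exact Finset.mem_coe.2 (Finset.mem_image_of_mem _ (Finset.mem_image_of_mem _ hp))
  refine ⟨F, h2, h1, ∑ p : S, (⟨p.1.1 ^ q ^ n, hmem _ p.2⟩ : F) ⊗ₜ (p.1.2 ^ q ^ n), ?_⟩
  have : ExpChar (K ⊗[ℓ] C) q :=
    expChar_of_injective_ringHom (algebraMap ℓ (K ⊗[ℓ] C)).injective q
  rw [← hpow, hS, sum_pow_char_pow, map_sum, ← Finset.sum_coe_sort S]
  simp [Algebra.TensorProduct.tmul_pow]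

/-- Idempotents of `K ⊗ C` have coefficients in the finite-valued elements. -/
lemma exists_finiteValues_of_idempotent [IsAlgClosed K] {e : K ⊗[ℓ] C} (he : e * e = e) :
    ∃ y : K ⊗[ℓ] finiteValues ℓ K C,
      Algebra.TensorProduct.map (AlgHom.id K K) (finiteValues ℓ K C).val y = e := by
  classical
  obtain ⟨F, _, _, z, rfl⟩ := exists_finite_separable_of_idempotent he
  have hinj : Function.Injective (Algebra.TensorProduct.map F.val (AlgHom.id ℓ C)) :=
    Module.Flat.rTensor_preserves_injective_linearMap (M := C) F.val.toLinearMap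
      F.val.injective
  have hz : z * z = z := hinj (by rw [map_mul, he])
  let b := Module.finBasis ℓ F
  let d := TensorProduct.equivFinsuppOfBasisLeft (N := C) b z
  have hzd : z = ∑ j, b j ⊗ₜ d j := by
    apply (TensorProduct.equivFinsuppOfBasisLeft (N := C) b).injective
    ext i
    simp [d]
  -- A point `ρ` and an embedding `τ` together send the idempotent `z` to an idempotent of the field
  -- `K`, hence to `0` or `1`.
  have hfin : (Set.range fun (ρ : C →ₐ[ℓ] K) j ↦ ρ (d j)).Finite := by
    refine finite_range_of_embeddings K b _ fun ρ τ ↦ ?_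
    let E : F ⊗[ℓ] C →ₐ[ℓ] K := Algebra.TensorProduct.lift τ ρ fun _ _ ↦ Commute.all _ _
    have h1 : E z = ∑ j, τ (b j) * ρ (d j) := by
      simp [hzd, E]
    have h2 : E z * E z = E z := by rw [← map_mul, hz]
    rw [← h1]
    exact IsIdempotentElem.iff_eq_zero_or_one.1 h2
  have hd (j) : d j ∈ finiteValues ℓ K C := by
    refine (hfin.image fun v ↦ v j).subset ?_
    rintro _ ⟨ρ, rfl⟩
    exact ⟨_, ⟨ρ, rfl⟩, rfl⟩
  refine ⟨∑ j, (b j : K) ⊗ₜ ⟨d j, hd j⟩, ?_⟩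
  rw [hzd]
  simp

end FiniteValues

/-! ### Evaluation at points after base change -/

section PtEval

variable {ℓ K C D : Type*} [Field ℓ] [Field K] [Algebra ℓ K] [CommRing C] [Algebra ℓ C]
  [CommRing D] [Algebra ℓ D]

/-- The value of a function in `K ⊗ C` at a `K`-point of `C`. -/
def ptEval (ρ : C →ₐ[ℓ] K) : K ⊗[ℓ] C →ₐ[K] K :=
  Algebra.TensorProduct.lift (AlgHom.id K K) ρ fun _ _ ↦ Commute.all _ _

@[simp] lemma ptEval_tmul (ρ : C →ₐ[ℓ] K) (a : K) (c : C) : ptEval ρ (a ⊗ₜ c) = a * ρ c := by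
  simp [ptEval]

lemma liftBaseChange_toLinearMap (ρ : C →ₐ[ℓ] K) (x : K ⊗[ℓ] C) :
    ρ.toLinearMap.liftBaseChange K x = ptEval ρ x := by
  induction x with
  | zero => simp
  | add a b ha hb => rw [map_add, map_add, ha, hb]
  | tmul a b => simp

lemma ptEval_map (f : C →ₐ[ℓ] D) (ρ : D →ₐ[ℓ] K) (x : K ⊗[ℓ] C) :
    ptEval ρ (Algebra.TensorProduct.map (AlgHom.id K K) f x) = ptEval (ρ.comp f) x := by
  induction x with
  | zero => simp
  | add a b ha hb => rw [map_add, map_add, map_add, ha, hb]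
  | tmul a b => simp

lemma separates_algHom_of_isReduced [IsAlgClosed K] [Algebra.FiniteType ℓ C]
    [IsReduced (K ⊗[ℓ] C)] : Separates fun ρ : C →ₐ[ℓ] K ↦ ρ.toLinearMap := by
  intro x hx
  refine eq_zero_of_forall_algHom K fun f ↦ ?_
  have hf : f = ptEval ((f.restrictScalars ℓ).comp Algebra.TensorProduct.includeRight) := by
    ext c
    simp
  rw [hf, ← liftBaseChange_toLinearMap]
  exact hx _

end PtEval

/-! ### Functions on the pieces of a decomposition -/

section Components

variable {ℓ K C : Type*} [Field ℓ] [Field K] [Algebra ℓ K] [CommRing C] [Algebra ℓ C]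

/-- A finite decomposition `π : X → Y` of a set of `K`-points of `C` into pieces such that
finite-valued functions are constant on the pieces, and the indicator functions of the pieces
are algebraic. -/
structure IsDecomposition {X Y : Type*} (p : X → (C →ₐ[ℓ] K)) (π : X → Y) : Prop where
  separates : Separates fun x : X ↦ (p x).toLinearMap
  point_surjective : Function.Surjective p
  surjective : Function.Surjective π
  apply_eq : ∀ c ∈ finiteValues ℓ K C, ∀ x x', π x = π x' → p x c = p x' c
  exists_indicator : ∀ y, ∃ e : K ⊗[ℓ] C, ∀ x, (π x = y → ptEval (p x) e = 1) ∧
    (π x ≠ y → ptEval (p x) e = 0)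

namespace IsDecomposition

variable {X Y : Type*} {p : X → (C →ₐ[ℓ] K)} {π : X → Y} (h : IsDecomposition p π)

include h in
lemma ext {x y : K ⊗[ℓ] C} (hxy : ∀ z, ptEval (p z) x = ptEval (p z) y) : x = y := by
  rw [← sub_eq_zero]
  refine h.separates _ fun z ↦ ?_
  rw [liftBaseChange_toLinearMap, map_sub, hxy, sub_self]

/-- The value of a finite-valued function on a piece. -/
def value (y : Y) : finiteValues ℓ K C →ₐ[ℓ] K :=
  (p (Function.surjInv h.surjective y)).comp (finiteValues ℓ K C).val

lemma value_apply (x : X) (c : finiteValues ℓ K C) : h.value (π x) c = p x c :=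
  h.apply_eq c c.2 _ _ (Function.surjInv_eq h.surjective (π x))

/-- Evaluation of `K`-linear combinations of finite-valued functions on the pieces. -/
def values : K ⊗[ℓ] finiteValues ℓ K C →ₐ[K] (Y → K) := AlgHom.pi fun y ↦ ptEval (h.value y)

lemma values_apply (z : K ⊗[ℓ] finiteValues ℓ K C) (y : Y) :
    h.values z y = ptEval (h.value y) z := rfl

lemma values_apply_point (z : K ⊗[ℓ] finiteValues ℓ K C) (x : X) :
    h.values z (π x) =
      ptEval (p x) (Algebra.TensorProduct.map (AlgHom.id K K) (finiteValues ℓ K C).val z) := by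
  rw [values_apply, ptEval_map]
  congr 2
  ext c
  exact h.value_apply x c

/-- Flatness embeds `K ⊗ finiteValues` into `K ⊗ C`, where the points separate. -/
lemma values_injective : Function.Injective h.values := by
  intro z z' hz
  have hi : Function.Injective
      (Algebra.TensorProduct.map (AlgHom.id K K) (finiteValues ℓ K C).val) :=
    Module.Flat.lTensor_preserves_injective_linearMap (M := K)
      (finiteValues ℓ K C).val.toLinearMap Subtype.val_injective
  exact hi (h.ext fun x ↦ by rw [← h.values_apply_point, hz, h.values_apply_point])

/-- The indicator of a piece is idempotent, since it is so at every point and the points separate;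
hence it lies in `K ⊗ finiteValues`. Indicators span the functions on a finite set. -/
lemma values_surjective [Finite Y] [IsAlgClosed K] [Algebra.IsAlgebraic ℓ K] :
    Function.Surjective h.values := by
  classical
  have := Fintype.ofFinite Y
  have hs (y : Y) : ∃ z, h.values z = Pi.single y 1 := by
    obtain ⟨e, he⟩ := h.exists_indicator y
    have hee : e * e = e := h.ext fun x ↦ by
      by_cases hx : π x = y
      · simp [(he x).1 hx]
      · simp [(he x).2 hx]
    obtain ⟨z, rfl⟩ := exists_finiteValues_of_idempotent hee
    refine ⟨z, funext fun y' ↦ ?_⟩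
    obtain ⟨x, rfl⟩ := h.surjective y'
    rw [h.values_apply_point]
    by_cases hx : π x = y
    · subst hx; simp [(he x).1]
    · simp [(he x).2 hx, hx]
  choose z hz using hs
  intro f
  refine ⟨∑ y, f y • z y, ?_⟩
  simp only [map_sum, map_smul, hz]
  exact (pi_eq_sum_univ' f).symm

lemma values_bijective [Finite Y] [IsAlgClosed K] [Algebra.IsAlgebraic ℓ K] :
    Function.Bijective h.values := ⟨h.values_injective, h.values_surjective⟩

end IsDecomposition

end Components

/-! ### The maximal unramified subalgebra -/

section Unramified

variable {ℓ C : Type*} [Field ℓ] [CommRing C] [Algebra ℓ C]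

lemma IsUnramified.finite (h : IsUnramified ℓ C) : Module.Finite ℓ C := by
  obtain ⟨r, ⟨e⟩⟩ := h
  have : Module.Finite (AlgebraicClosure ℓ) (AlgebraicClosure ℓ ⊗[ℓ] C) :=
    Module.Finite.equiv e.symm.toLinearEquiv
  exact Module.Finite.of_finite_tensorProduct_of_faithfullyFlat (AlgebraicClosure ℓ)

lemma IsUnramified.formallyUnramified (h : IsUnramified ℓ C) : Algebra.FormallyUnramified ℓ C := by
  obtain ⟨r, ⟨e⟩⟩ := h
  have : Algebra.FormallyUnramified (AlgebraicClosure ℓ) (AlgebraicClosure ℓ ⊗[ℓ] C) :=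
    .of_equiv e.symm
  exact .of_formallyUnramified_tensorProduct_of_faithfullyFlat (AlgebraicClosure ℓ)

/-- The image of `ρ` is a field, being a subalgebra of an algebraic extension. As a quotient of `C`
it is finite and formally unramified, hence separable over `ℓ`. -/
lemma isSeparable_of_formallyUnramified [Module.Finite ℓ C] [Algebra.FormallyUnramified ℓ C]
    {K : Type*} [Field K] [Algebra ℓ K] [Algebra.IsAlgebraic ℓ K] (ρ : C →ₐ[ℓ] K) (c : C) :
    IsSeparable ℓ (ρ c) := by
  obtain ⟨F, hF⟩ : ∃ F : IntermediateField ℓ K, F.toSubalgebra = ρ.range :=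
    ⟨ρ.range.toIntermediateField fun x hx ↦
      ρ.range.inv_mem_of_algebraic (x := ⟨x, hx⟩) (Algebra.IsAlgebraic.isAlgebraic _),
      toSubalgebra_toIntermediateField _ _⟩
  have hF' (x : K) : x ∈ F ↔ ∃ c, ρ c = x := by
    rw [← IntermediateField.mem_toSubalgebra, hF, AlgHom.mem_range]
  let g : C →ₐ[ℓ] F := ρ.codRestrict F.toSubalgebra fun c ↦ (hF' _).2 ⟨c, rfl⟩
  have hg : Function.Surjective g := fun x ↦ by
    obtain ⟨c, hc⟩ := (hF' x).1 x.2
    exact ⟨c, Subtype.ext hc⟩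
  have : Algebra.FormallyUnramified ℓ F := .of_surjective g hg
  have : Module.Finite ℓ F := Module.Finite.of_surjective g.toLinearMap hg
  have := Algebra.FormallyUnramified.isSeparable ℓ F
  obtain ⟨x, hx⟩ : ∃ x : F, F.val x = ρ c := ⟨⟨ρ c, (hF' _).2 ⟨c, rfl⟩⟩, rfl⟩
  have hs : IsSeparable ℓ x := Algebra.IsSeparable.isSeparable ℓ x
  rw [← hx]
  exact hs.map F.val F.val.injective

lemma IsUnramified.isSeparable (h : IsUnramified ℓ C) {K : Type*} [Field K] [Algebra ℓ K]
    [Algebra.IsAlgebraic ℓ K] (ρ : C →ₐ[ℓ] K) (c : C) : IsSeparable ℓ (ρ c) :=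
  have := h.finite
  have := h.formallyUnramified
  isSeparable_of_formallyUnramified ρ c

lemma IsDecomposition.isUnramified {X Y : Type*} {p : X → (C →ₐ[ℓ] AlgebraicClosure ℓ)}
    {π : X → Y} [Finite Y] (h : IsDecomposition p π) :
    IsUnramified ℓ (finiteValues ℓ (AlgebraicClosure ℓ) C) :=
  ⟨Nat.card Y, ⟨(AlgEquiv.ofBijective h.values h.values_bijective).trans
    (AlgEquiv.piCongrLeft (AlgebraicClosure ℓ) (fun _ ↦ AlgebraicClosure ℓ) (Finite.equivFin Y))⟩⟩

/-- An unramified subalgebra is finite over `ℓ`, so its elements are integral and take finitely many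
values. -/
lemma IsDecomposition.isGreatest {X Y : Type*} {p : X → (C →ₐ[ℓ] AlgebraicClosure ℓ)}
    {π : X → Y} [Finite Y] (h : IsDecomposition p π) :
    IsGreatest {S : Subalgebra ℓ C | IsUnramified ℓ S}
      (finiteValues ℓ (AlgebraicClosure ℓ) C) := by
  refine ⟨h.isUnramified, fun S (hS : IsUnramified ℓ S) c hc ↦ ?_⟩
  have := hS.finite
  exact mem_finiteValues_of_isIntegral
    ((Algebra.IsIntegral.isIntegral (R := ℓ) (⟨c, hc⟩ : S)).map S.val)

lemma IsDecomposition.piZero_eq {X Y : Type*} {p : X → (C →ₐ[ℓ] AlgebraicClosure ℓ)}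
    {π : X → Y} [Finite Y] (h : IsDecomposition p π) :
    piZero ℓ C = finiteValues ℓ (AlgebraicClosure ℓ) C :=
  h.isGreatest.isLUB.sSup_eq

end Unramified

/-! ### Smoothness of the representation scheme -/

section RepRingProperties

lemma finiteType_baseChange (ℓ K A : Type*) [Field ℓ] [Field K] [Algebra ℓ K] [Ring A]
    [Algebra ℓ A] [Algebra.FiniteType ℓ A] : Algebra.FiniteType K (K ⊗[ℓ] A) := by
  classical
  obtain ⟨S, hS⟩ := (inferInstance : Algebra.FiniteType ℓ A).out
  refine ⟨⟨S.image (fun a ↦ (1 : K) ⊗ₜ[ℓ] a), ?_⟩⟩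
  have key (a : A) : (1 : K) ⊗ₜ[ℓ] a ∈ Algebra.adjoin K
      (↑(S.image (fun a ↦ (1 : K) ⊗ₜ[ℓ] a)) : Set (K ⊗[ℓ] A)) := by
    have ha : a ∈ Algebra.adjoin ℓ (S : Set A) := hS ▸ Algebra.mem_top
    induction ha using Algebra.adjoin_induction with
    | mem x hx => exact Algebra.subset_adjoin (by simpa using ⟨x, hx, rfl⟩)
    | algebraMap r =>
      have : (1 : K) ⊗ₜ[ℓ] algebraMap ℓ A r = algebraMap K (K ⊗[ℓ] A) (algebraMap ℓ K r) := by
        rw [Algebra.TensorProduct.algebraMap_apply, Algebra.algebraMap_eq_smul_one,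
          Algebra.algebraMap_self, RingHom.id_apply, Algebra.algebraMap_eq_smul_one,
          TensorProduct.smul_tmul]
      rw [this]
      exact Subalgebra.algebraMap_mem _ _
    | add x y _ _ hx hy => rw [TensorProduct.tmul_add]; exact add_mem hx hy
    | mul x y _ _ hx hy =>
      rw [show (1 : K) ⊗ₜ[ℓ] (x * y) = (1 ⊗ₜ x) * (1 ⊗ₜ y) by simp]
      exact mul_mem hx hy
  refine eq_top_iff.2 fun x _ ↦ ?_
  induction x with
  | zero => exact zero_mem _
  | add a b ha hb => exact add_mem (ha trivial) (hb trivial)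
  | tmul c a =>
    rw [← mul_one c, ← smul_eq_mul, ← TensorProduct.smul_tmul']
    exact Subalgebra.smul_mem _ (key a) c

variable {ℓ : Type u} {A : Type v} [Field ℓ] [Ring A] [Algebra ℓ A] {n : ℕ}

/-- The matrix entries of generators of `A` generate, because the universal representation is a
homomorphism. -/
lemma RepRing.finiteType [Algebra.FiniteType ℓ A] : Algebra.FiniteType ℓ (RepRing ℓ A n) := by
  classical
  obtain ⟨S, hS⟩ := (inferInstance : Algebra.FiniteType ℓ A).out
  let T : Finset (RepRing ℓ A n) :=
    (S ×ˢ (Finset.univ : Finset (Fin n × Fin n))).image fun x ↦ coord x.1 x.2.1 x.2.2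
  refine ⟨⟨T, ?_⟩⟩
  have key (a : A) : ∀ i j, (coord a i j : RepRing ℓ A n) ∈
      Algebra.adjoin ℓ (T : Set (RepRing ℓ A n)) := by
    have ha : a ∈ Algebra.adjoin ℓ (S : Set A) := hS ▸ Algebra.mem_top
    induction ha using Algebra.adjoin_induction with
    | mem x hx =>
      intro i j
      refine Algebra.subset_adjoin ?_
      simp only [T, Finset.coe_image, Set.mem_image]
      exact ⟨(x, i, j), by simpa using hx, rfl⟩
    | algebraMap r =>
      intro i j
      rw [← univ_apply, AlgHom.commutes, Matrix.algebraMap_matrix_apply]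
      split_ifs
      · exact Subalgebra.algebraMap_mem _ _
      · exact zero_mem _
    | add x y _ _ hx hy =>
      intro i j
      rw [← univ_apply, map_add]
      exact add_mem (hx i j) (hy i j)
    | mul x y _ _ hx hy =>
      intro i j
      rw [← univ_apply, map_mul, Matrix.mul_apply]
      exact sum_mem fun l _ ↦ mul_mem (hx i l) (hy l j)
  refine eq_top_iff.2 fun x _ ↦ ?_
  induction x using RepRing.induction_on with
  | hC c => exact Subalgebra.algebraMap_mem _ _
  | hadd f g hf hg => exact add_mem (hf trivial) (hg trivial)
  | hmul f a i j hf => exact mul_mem (hf trivial) (key a i j)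

/-- The representation ring of a qurve is formally smooth. -/
lemma IsQurve.formallySmooth_repRing (hA : IsQurve ℓ A) (n : ℕ) :
    Algebra.FormallySmooth ℓ (RepRing ℓ A n) := by
  refine Algebra.FormallySmooth.of_comp_surjective fun B _ _ I hI f ↦ ?_
  let π : Matrix (Fin n) (Fin n) B →ₐ[ℓ] Matrix (Fin n) (Fin n) (B ⧸ I) :=
    (Ideal.Quotient.mkₐ ℓ I).mapMatrix
  have hπ : Function.Surjective π := fun M ↦ by
    choose N hN using fun i j ↦ Ideal.Quotient.mk_surjective (M i j)
    exact ⟨Matrix.of N, Matrix.ext fun i j ↦ hN i j⟩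
  let J := RingHom.ker π
  -- `J` consists of the matrices with entries in `I`, so `I ^ 2 = ⊥` gives `J ^ 2 = ⊥`. The lifting
  -- property of `A` then applies to the noncommutative extension `M_n(B) → M_n(B/I)`.
  have hJ : IsNilpotent J := by
    refine ⟨2, ?_⟩
    rw [Submodule.pow_succ, Submodule.pow_one, Submodule.zero_eq_bot, eq_bot_iff]
    refine Ideal.mul_le.2 fun M hM N hN ↦ ?_
    have hmem {M : Matrix (Fin n) (Fin n) B} (hM : M ∈ J) (i j : Fin n) : M i j ∈ I :=
      Ideal.Quotient.eq_zero_iff_mem.1 (congrFun (congrFun (show π M = 0 from hM) i) j)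
    rw [Ideal.mem_bot]
    ext i j
    rw [Matrix.mul_apply]
    refine Finset.sum_eq_zero fun l _ ↦ ?_
    have := Ideal.mul_mem_mul (hmem hM i l) (hmem hN l j)
    rwa [← pow_two, hI, Ideal.mem_bot] at this
  let ε := Ideal.quotientKerAlgEquivOfSurjective hπ
  obtain ⟨ψ, hψ⟩ := hA.exists_lift _ J hJ (ε.symm.toAlgHom.comp (f.mapMatrix.comp (RepRing.univ ℓ A n)))
  refine ⟨RepRing.lift ψ, RepRing.algHom_ext fun a i j ↦ ?_⟩
  have h1 : π (ψ a) = f.mapMatrix (RepRing.univ ℓ A n a) := by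
    have := congrArg ε (DFunLike.congr_fun hψ a)
    simp only [AlgHom.comp_apply, Ideal.Quotient.mkₐ_eq_mk, AlgEquiv.coe_toAlgHom,
      AlgEquiv.apply_symm_apply, ε] at this
    exact this
  have h2 := congrFun (congrFun h1 i) j
  simpa [π] using h2

lemma IsQurve.smooth_repRing (hA : IsQurve ℓ A) (n : ℕ) : Algebra.Smooth ℓ (RepRing ℓ A n) := by
  have := hA.finiteType
  have := RepRing.finiteType (ℓ := ℓ) (A := A) (n := n)
  have := hA.formallySmooth_repRing n
  exact ⟨inferInstance, Algebra.FinitePresentation.of_finiteType.1 inferInstance⟩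

end RepRingProperties

/-! ### Representations of `K ⊗ A` as points of the representation scheme -/

section Points

variable {ℓ : Type u} {A : Type v} [Field ℓ] [Ring A] [Algebra ℓ A] {n : ℕ}
  {K : Type w} [Field K] [Algebra ℓ K]

/-- The `K`-point of `ℓ[rep_n A]` given by an `n`-dimensional representation of `K ⊗ A`. -/
def RepPt.toAlgHom (ρ : RepPt K (K ⊗[ℓ] A) n) : RepRing ℓ A n →ₐ[ℓ] K :=
  RepRing.lift ((ρ.restrictScalars ℓ).comp Algebra.TensorProduct.includeRight)

@[simp] lemma RepPt.toAlgHom_coord (ρ : RepPt K (K ⊗[ℓ] A) n) (a : A) (i j : Fin n) :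
    ρ.toAlgHom (RepRing.coord a i j) = ρ (1 ⊗ₜ a) i j := by
  simp [toAlgHom]

lemma RepPt.toAlgHom_surjective :
    Function.Surjective (toAlgHom : RepPt K (K ⊗[ℓ] A) n → (RepRing ℓ A n →ₐ[ℓ] K)) := by
  intro f
  refine ⟨Algebra.TensorProduct.lift (Algebra.ofId K _) (f.mapMatrix.comp (RepRing.univ ℓ A n))
    fun x y ↦ show Commute _ _ from Algebra.commutes x _, RepRing.algHom_ext fun a i j ↦ ?_⟩
  rw [RepPt.toAlgHom_coord]
  simp

lemma RepPt.exists_lift_eq_toAlgHom (c : RepRing ℓ A n) :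
    ∃ f : RepRing K (K ⊗[ℓ] A) n, ∀ ρ : RepPt K (K ⊗[ℓ] A) n,
      RepRing.lift ρ f = ρ.toAlgHom c := by
  induction c using RepRing.induction_on with
  | hC c => exact ⟨algebraMap K _ (algebraMap ℓ K c), fun ρ ↦ by simp⟩
  | hadd a b ha hb =>
    obtain ⟨f, hf⟩ := ha
    obtain ⟨g, hg⟩ := hb
    exact ⟨f + g, fun ρ ↦ by rw [map_add, map_add, hf, hg]⟩
  | hmul b a i j hb =>
    obtain ⟨f, hf⟩ := hb
    exact ⟨f * RepRing.coord (1 ⊗ₜ a) i j, fun ρ ↦ by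
      rw [map_mul, map_mul, hf, RepRing.lift_coord, toAlgHom_coord]⟩

/-- With `RepPt.exists_lift_eq_toAlgHom`, this compares functions on `rep_n(K ⊗ A)` with elements of
`K ⊗ ℓ[rep_n A]`; agreement at points suffices, so no isomorphism of the two rings is needed. -/
lemma RepPt.exists_ptEval_eq_lift (f : RepRing K (K ⊗[ℓ] A) n) :
    ∃ g : K ⊗[ℓ] RepRing ℓ A n, ∀ ρ : RepPt K (K ⊗[ℓ] A) n,
      ptEval ρ.toAlgHom g = RepRing.lift ρ f := by
  induction f using RepRing.induction_on with
  | hC c => exact ⟨algebraMap K _ c, fun ρ ↦ by simp⟩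
  | hadd a b ha hb =>
    obtain ⟨f, hf⟩ := ha
    obtain ⟨g, hg⟩ := hb
    exact ⟨f + g, fun ρ ↦ by rw [map_add, map_add, hf, hg]⟩
  | hmul b a i j hb =>
    obtain ⟨f, hf⟩ := hb
    suffices ∃ g : K ⊗[ℓ] RepRing ℓ A n, ∀ ρ : RepPt K (K ⊗[ℓ] A) n,
        ptEval ρ.toAlgHom g = ρ a i j by
      obtain ⟨g, hg⟩ := this
      exact ⟨f * g, fun ρ ↦ by rw [map_mul, map_mul, hf, hg, RepRing.lift_coord]⟩
    induction a with
    | zero => exact ⟨0, fun ρ ↦ by simp⟩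
    | add a b ha hb =>
      obtain ⟨f, hf⟩ := ha
      obtain ⟨g, hg⟩ := hb
      exact ⟨f + g, fun ρ ↦ by rw [map_add, map_add, hf, hg, Matrix.add_apply]⟩
    | tmul c a =>
      refine ⟨c ⊗ₜ RepRing.coord a i j, fun ρ ↦ ?_⟩
      rw [ptEval_tmul, RepPt.toAlgHom_coord, ← mul_one c, ← smul_eq_mul c 1,
        ← TensorProduct.smul_tmul', map_smul]
      simp

lemma RepPt.noetherianSpace [Algebra.FiniteType ℓ A] :
    TopologicalSpace.NoetherianSpace (RepPt K (K ⊗[ℓ] A) n) := by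
  have := finiteType_baseChange ℓ K A
  have := RepRing.finiteType (ℓ := K) (A := K ⊗[ℓ] A) (n := n)
  have : IsNoetherianRing (RepRing K (K ⊗[ℓ] A) n) := Algebra.FiniteType.isNoetherianRing K _
  exact Topology.IsInducing.noetherianSpace (i := RepPt.toPrime) ⟨rfl⟩

lemma IsQurve.finite_components (hA : IsQurve ℓ A) (n : ℕ) :
    Finite (ConnectedComponents (RepPt K (K ⊗[ℓ] A) n)) := by
  have := hA.finiteType
  have := RepPt.noetherianSpace (ℓ := ℓ) (A := A) (K := K) (n := n)
  exact finite_connectedComponents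

variable [IsAlgClosed K]

/-- The functions separate complementary closed sets of points. -/
lemma RepPt.exists_indicator [Algebra.FiniteType ℓ A] {U : Set (RepPt K (K ⊗[ℓ] A) n)}
    (hU : IsClopen U) : ∃ f : RepRing K (K ⊗[ℓ] A) n,
      ∀ ρ, (ρ ∈ U → RepRing.lift ρ f = 1) ∧ (ρ ∉ U → RepRing.lift ρ f = 0) := by
  have := finiteType_baseChange ℓ K A
  have := RepRing.finiteType (ℓ := K) (A := K ⊗[ℓ] A) (n := n)
  obtain ⟨s, hs⟩ := RepPt.isClosed_iff.1 hU.1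
  obtain ⟨t, ht⟩ := RepPt.isClosed_iff.1 hU.compl.1
  -- A proper ideal would have a `K`-point, lying both in `U` and in its complement.
  have htop : Ideal.span s ⊔ Ideal.span t = ⊤ := by
    by_contra hne
    obtain ⟨f, hf⟩ := exists_algHom_of_ne_top (K := K) hne
    obtain ⟨ρ, rfl⟩ := (RepRing.homEquiv K (K ⊗[ℓ] A) n K).surjective f
    have h1 : ρ ∈ U := by
      rw [hs]
      exact fun g hg ↦ hf g (Ideal.mem_sup_left (Ideal.subset_span hg))
    have h2 : ρ ∈ Uᶜ := by
      rw [ht]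
      exact fun g hg ↦ hf g (Ideal.mem_sup_right (Ideal.subset_span hg))
    exact h2 h1
  have hspan {s : Set (RepRing K (K ⊗[ℓ] A) n)} {ρ : RepPt K (K ⊗[ℓ] A) n}
      (h : ∀ g ∈ s, RepRing.lift ρ g = 0) {a : RepRing K (K ⊗[ℓ] A) n} (ha : a ∈ Ideal.span s) :
      RepRing.lift ρ a = 0 :=
    (Ideal.span_le (I := RingHom.ker (RepRing.lift ρ))).2 h ha
  -- In `a + b = 1`, `a` vanishes on `U` and `b` off `U`; so `b` is the indicator of `U`.
  obtain ⟨a, ha, b, hb, hab⟩ := Submodule.mem_sup.1 ((Ideal.eq_top_iff_one _).1 htop)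
  refine ⟨b, fun ρ ↦ ⟨fun hρ ↦ ?_, fun hρ ↦ ?_⟩⟩
  · rw [hs] at hρ
    have := congrArg (RepRing.lift ρ) hab
    rwa [map_add, hspan hρ ha, zero_add, map_one] at this
  · have hρ' : ρ ∈ Uᶜ := hρ
    rw [ht] at hρ'
    exact hspan hρ' hb

lemma IsQurve.separates (hA : IsQurve ℓ A) (n : ℕ) :
    Separates fun ρ : RepPt K (K ⊗[ℓ] A) n ↦ ρ.toAlgHom.toLinearMap := by
  have := hA.finiteType
  have := RepRing.finiteType (ℓ := ℓ) (A := A) (n := n)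
  have := hA.smooth_repRing n
  have : IsReduced (K ⊗[ℓ] RepRing ℓ A n) := isReduced_of_smooth K _
  intro x hx
  refine separates_algHom_of_isReduced x fun f ↦ ?_
  obtain ⟨ρ, rfl⟩ := RepPt.toAlgHom_surjective f
  exact hx ρ

/-- A finite-valued function is constant on components since its fibers are Zariski closed.
Components are clopen because there are finitely many, so their indicators are regular functions. -/
lemma IsQurve.isDecomposition (hA : IsQurve ℓ A) (n : ℕ) :
    IsDecomposition (RepPt.toAlgHom : RepPt K (K ⊗[ℓ] A) n → (RepRing ℓ A n →ₐ[ℓ] K))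
      (ConnectedComponents.mk : _ → ConnectedComponents (RepPt K (K ⊗[ℓ] A) n)) := by
  have := hA.finiteType
  have := hA.finite_components (K := K) n
  refine ⟨hA.separates n, RepPt.toAlgHom_surjective, ConnectedComponents.surjective_coe, ?_, ?_⟩
  · intro c hc ρ ρ' h
    refine eq_of_connectedComponents_eq (f := fun ρ : RepPt K (K ⊗[ℓ] A) n ↦ ρ.toAlgHom c)
      (hc.subset ?_) (fun z ↦ ?_) h
    · rintro _ ⟨ρ, rfl⟩
      exact ⟨ρ.toAlgHom, rfl⟩
    · obtain ⟨f, hf⟩ := RepPt.exists_lift_eq_toAlgHom (K := K) c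
      refine RepPt.isClosed_iff.2 ⟨{f - algebraMap K _ z}, ?_⟩
      ext ρ
      simp [hf, sub_eq_zero]
  · intro y
    obtain ⟨f, hf⟩ := RepPt.exists_indicator (isClopen_connectedComponents_fiber y)
    obtain ⟨g, hg⟩ := RepPt.exists_ptEval_eq_lift f
    exact ⟨g, fun ρ ↦ ⟨fun h ↦ (hg ρ).trans ((hf ρ).1 h), fun h ↦ (hg ρ).trans ((hf ρ).2 h)⟩⟩

end Points

/-! ### The algebras `π₀(n)` and the maps `Δ_{m,n}` -/

section PiRep

lemma finiteValues_le_of_algEquiv {ℓ K K' : Type*} (C : Type*) [Field ℓ] [Field K] [Algebra ℓ K]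
    [Field K'] [Algebra ℓ K'] [CommRing C] [Algebra ℓ C] (e : K ≃ₐ[ℓ] K') :
    finiteValues ℓ K C ≤ finiteValues ℓ K' C := by
  intro c hc
  refine (hc.image e).subset ?_
  rintro _ ⟨ρ, rfl⟩
  exact ⟨_, ⟨e.symm.toAlgHom.comp ρ, rfl⟩, by simp⟩

lemma IsDecomposition.exists_values {ℓ K C : Type*} [Field ℓ] [Field K] [Algebra ℓ K]
    [CommRing C] [Algebra ℓ C] [IsAlgClosed K] [Algebra.IsAlgebraic ℓ K]
    {X Y : Type*} [Finite Y] {p : X → (C →ₐ[ℓ] K)} {π : X → Y} (h : IsDecomposition p π)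
    {P : Subalgebra ℓ C} (hP : P = finiteValues ℓ K C) :
    ∃ Φ : K ⊗[ℓ] P ≃ₐ[K] (Y → K), ∀ z x,
      Φ z (π x) = ptEval ((p x).comp P.val) z := by
  subst hP
  refine ⟨AlgEquiv.ofBijective h.values h.values_bijective, fun z x ↦ ?_⟩
  rw [← ptEval_map]
  exact h.values_apply_point z x

/-- An `ℓ`-linear retraction `K → ℓ` of the inclusion pushes `z` down to a preimage of `w`. -/
lemma mem_range_of_baseChange {ℓ K V W : Type*} [Field ℓ] [Field K] [Algebra ℓ K] [AddCommGroup V]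
    [Module ℓ V] [AddCommGroup W] [Module ℓ W] (f : V →ₗ[ℓ] W) (z : K ⊗[ℓ] V) (w : W)
    (h : f.lTensor K z = 1 ⊗ₜ w) : w ∈ LinearMap.range f := by
  obtain ⟨r, hr⟩ := (Algebra.linearMap ℓ K).exists_leftInverse_of_injective
    (LinearMap.ker_eq_bot.2 (algebraMap ℓ K).injective)
  have hr1 : r 1 = 1 := by simpa using LinearMap.congr_fun hr 1
  refine ⟨TensorProduct.lid ℓ V (r.rTensor V z), ?_⟩
  have h1 : TensorProduct.lid ℓ W (r.rTensor W (f.lTensor K z)) = w := by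
    rw [h]; simp [hr1]
  rw [← h1]
  generalize z = z
  induction z with
  | zero => simp
  | add a b ha hb => simp only [map_add, ha, hb]
  | tmul a b => simp

variable {ℓ : Type u} {A : Type v} [Field ℓ] [Ring A] [Algebra ℓ A]

lemma IsQurve.piRep_eq_algebraicClosure (hA : IsQurve ℓ A) (n : ℕ) :
    piRep ℓ A n = finiteValues ℓ (AlgebraicClosure ℓ) (RepRing ℓ A n) :=
  have := hA.finite_components (K := AlgebraicClosure ℓ) n
  (hA.isDecomposition (K := AlgebraicClosure ℓ) n).piZero_eq

lemma IsQurve.isGreatest_piRep (hA : IsQurve ℓ A) (n : ℕ) :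
    IsGreatest {S : Subalgebra ℓ (RepRing ℓ A n) | IsUnramified ℓ S} (piRep ℓ A n) := by
  have := hA.finite_components (K := AlgebraicClosure ℓ) n
  rw [hA.piRep_eq_algebraicClosure]
  exact (hA.isDecomposition (K := AlgebraicClosure ℓ) n).isGreatest

variable {K : Type w} [Field K] [Algebra ℓ K]

lemma RepPt.lift_sumComap {m n N : ℕ} (h : m + n = N) (ρ : RepPt K (K ⊗[ℓ] A) m)
    (σ : RepPt K (K ⊗[ℓ] A) n) (c : RepRing ℓ A N) :
    Algebra.TensorProduct.lift ρ.toAlgHom σ.toAlgHom (fun _ _ ↦ Commute.all _ _)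
      (sumComap ℓ A h c) = (RepPt.sum h ρ σ).toAlgHom c := by
  suffices (Algebra.TensorProduct.lift ρ.toAlgHom σ.toAlgHom (fun _ _ ↦ Commute.all _ _)).comp
      (sumComap ℓ A h) = (RepPt.sum h ρ σ).toAlgHom from DFunLike.congr_fun this c
  refine RepRing.algHom_ext fun a i j ↦ ?_
  obtain ⟨i, rfl⟩ := (finSumEquiv h).surjective i
  obtain ⟨j, rfl⟩ := (finSumEquiv h).surjective j
  rw [AlgHom.comp_apply, sumComap, RepRing.lift_coord, dirSum_apply, RepPt.toAlgHom_coord,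
    RepPt.sum, dirSum_apply]
  rcases i with i | i <;> rcases j with j | j <;> simp

lemma RepPt.mk_sum_eq {m n N : ℕ} (h : m + n = N) {ρ ρ' : RepPt K (K ⊗[ℓ] A) m}
    {σ σ' : RepPt K (K ⊗[ℓ] A) n}
    (hρ : ConnectedComponents.mk ρ = ConnectedComponents.mk ρ')
    (hσ : ConnectedComponents.mk σ = ConnectedComponents.mk σ') :
    ConnectedComponents.mk (RepPt.sum h ρ σ) = ConnectedComponents.mk (RepPt.sum h ρ' σ') := by
  have h1 : Comp.of ρ + Comp.of σ = Comp.of ρ' + Comp.of σ' := by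
    simp only [Comp.of, hρ, hσ]
  rw [Comp.of_add_of h, Comp.of_add_of h] at h1
  exact eq_of_heq (Sigma.mk.inj h1).2

variable [IsAlgClosed K] [Algebra.IsAlgebraic ℓ K]

variable (K) in
lemma IsQurve.piRep_eq (hA : IsQurve ℓ A) (n : ℕ) :
    piRep ℓ A n = finiteValues ℓ K (RepRing ℓ A n) := by
  have : IsAlgClosure ℓ K := ⟨inferInstance, inferInstance⟩
  let e := IsAlgClosure.equiv ℓ (AlgebraicClosure ℓ) K
  rw [hA.piRep_eq_algebraicClosure]
  exact le_antisymm (finiteValues_le_of_algEquiv _ e) (finiteValues_le_of_algEquiv _ e.symm)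

lemma IsQurve.exists_piRep_values (hA : IsQurve ℓ A) (n : ℕ) :
    ∃ Φ : K ⊗[ℓ] piRep ℓ A n ≃ₐ[K] (ConnectedComponents (RepPt K (K ⊗[ℓ] A) n) → K),
      ∀ z (ρ : RepPt K (K ⊗[ℓ] A) n),
        Φ z (ConnectedComponents.mk ρ) = ptEval (ρ.toAlgHom.comp (piRep ℓ A n).val) z :=
  have := hA.finite_components (K := K) n
  (hA.isDecomposition (K := K) n).exists_values (hA.piRep_eq K n)

variable (K) in
/-- Evaluation of combinations of elements of `π₀(n)` on components. -/
def piRepValues (hA : IsQurve ℓ A) (n : ℕ) :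
    K ⊗[ℓ] piRep ℓ A n ≃ₐ[K] (ConnectedComponents (RepPt K (K ⊗[ℓ] A) n) → K) :=
  (hA.exists_piRep_values n).choose

lemma piRepValues_apply (hA : IsQurve ℓ A) {n : ℕ} (z : K ⊗[ℓ] piRep ℓ A n)
    (ρ : RepPt K (K ⊗[ℓ] A) n) : piRepValues K hA n z (ConnectedComponents.mk ρ) =
      ptEval (ρ.toAlgHom.comp (piRep ℓ A n).val) z :=
  (hA.exists_piRep_values n).choose_spec z ρ

lemma piRep_apply_eq (hA : IsQurve ℓ A) {n : ℕ} (c : piRep ℓ A n) {ρ ρ' : RepPt K (K ⊗[ℓ] A) n}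
    (h : ConnectedComponents.mk ρ = ConnectedComponents.mk ρ') :
    ρ.toAlgHom (c : RepRing ℓ A n) = ρ'.toAlgHom (c : RepRing ℓ A n) := by
  simpa [piRepValues_apply] using congrArg (piRepValues K hA n (1 ⊗ₜ c)) h

variable (ℓ A) in
lemma piRepIncl_injective (m n : ℕ) : Function.Injective (piRepIncl ℓ A m n) :=
  TensorProduct.map_injective_of_flat_flat (piRep ℓ A m).val.toLinearMap
    (piRep ℓ A n).val.toLinearMap Subtype.val_injective Subtype.val_injective

/-- The value of `x` at `ρ ⊕ σ` depends only on the components of `ρ` and `σ`. Hence over `K` the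
pullback of `x` is a combination of products of indicators, all in `K ⊗ π₀(m) ⊗ π₀(n)`; the preimage
then descends to `ℓ`. -/
lemma IsQurve.exists_piRepIncl_eq (hA : IsQurve ℓ A) (K : Type w) [Field K] [Algebra ℓ K]
    [IsAlgClosed K] [Algebra.IsAlgebraic ℓ K] {m n N : ℕ} (h : m + n = N)
    (x : piRep ℓ A N) : ∃ y, piRepIncl ℓ A m n y = sumComap ℓ A h x := by
  classical
  have := hA.finite_components (K := K) m
  have := hA.finite_components (K := K) n
  have := Fintype.ofFinite (ConnectedComponents (RepPt K (K ⊗[ℓ] A) m))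
  have := Fintype.ofFinite (ConnectedComponents (RepPt K (K ⊗[ℓ] A) n))
  let F (a : ConnectedComponents (RepPt K (K ⊗[ℓ] A) m))
      (b : ConnectedComponents (RepPt K (K ⊗[ℓ] A) n)) : K :=
    (RepPt.sum h (Function.surjInv ConnectedComponents.surjective_coe a)
      (Function.surjInv ConnectedComponents.surjective_coe b)).toAlgHom (x : RepRing ℓ A N)
  have hF (ρ : RepPt K (K ⊗[ℓ] A) m) (σ : RepPt K (K ⊗[ℓ] A) n) :
      F (ConnectedComponents.mk ρ) (ConnectedComponents.mk σ) =
        (RepPt.sum h ρ σ).toAlgHom (x : RepRing ℓ A N) :=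
    piRep_apply_eq hA x (RepPt.mk_sum_eq h
      (Function.surjInv_eq ConnectedComponents.surjective_coe _)
      (Function.surjInv_eq ConnectedComponents.surjective_coe _))
  let L : K ⊗[ℓ] piRep ℓ A m →ₐ[K] K ⊗[ℓ] (piRep ℓ A m ⊗[ℓ] piRep ℓ A n) :=
    Algebra.TensorProduct.map (AlgHom.id K K) Algebra.TensorProduct.includeLeft
  let R : K ⊗[ℓ] piRep ℓ A n →ₐ[K] K ⊗[ℓ] (piRep ℓ A m ⊗[ℓ] piRep ℓ A n) :=
    Algebra.TensorProduct.map (AlgHom.id K K) Algebra.TensorProduct.includeRight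
  -- `W` is the element with value `F a b` on the product of the components `a` and `b`.
  let W : K ⊗[ℓ] (piRep ℓ A m ⊗[ℓ] piRep ℓ A n) := ∑ a, ∑ b,
    F a b • (L ((piRepValues K hA m).symm (Pi.single a 1)) *
      R ((piRepValues K hA n).symm (Pi.single b 1)))
  refine mem_range_of_baseChange (piRepIncl ℓ A m n).toLinearMap W _ ?_
  rw [← sub_eq_zero]
  refine (hA.separates (K := K) m).tmul (hA.separates (K := K) n) _ fun ⟨ρ, σ⟩ ↦ ?_
  let E : RepRing ℓ A m ⊗[ℓ] RepRing ℓ A n →ₐ[ℓ] K :=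
    Algebra.TensorProduct.lift ρ.toAlgHom σ.toAlgHom (fun _ _ ↦ Commute.all _ _)
  have hE : tmulFun ρ.toAlgHom.toLinearMap σ.toAlgHom.toLinearMap = E.toLinearMap := by
    ext a b
    simp [E]
  have hEL : (E.comp (piRepIncl ℓ A m n)).comp Algebra.TensorProduct.includeLeft =
      ρ.toAlgHom.comp (piRep ℓ A m).val := by
    ext a
    simp [E, piRepIncl]
  have hER : (E.comp (piRepIncl ℓ A m n)).comp Algebra.TensorProduct.includeRight =
      σ.toAlgHom.comp (piRep ℓ A n).val := by
    ext a
    simp [E, piRepIncl]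
  have h1 : ptEval E ((piRepIncl ℓ A m n).toLinearMap.lTensor K W) =
      F (ConnectedComponents.mk ρ) (ConnectedComponents.mk σ) := by
    have : (piRepIncl ℓ A m n).toLinearMap.lTensor K W =
      Algebra.TensorProduct.map (AlgHom.id K K) (piRepIncl ℓ A m n) W := rfl
    rw [this, ptEval_map]
    simp only [W, map_sum, map_smul, map_mul, L, R, ptEval_map, hEL, hER, ← piRepValues_apply hA,
      AlgEquiv.apply_symm_apply]
    rw [Finset.sum_eq_single (ConnectedComponents.mk ρ), Finset.sum_eq_single
      (ConnectedComponents.mk σ)]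
    · simp
    · intro b _ hb
      simp [hb.symm]
    · simp
    · intro a _ ha
      simp [ha.symm]
    · simp
  change LinearMap.liftBaseChange K (tmulFun ρ.toAlgHom.toLinearMap σ.toAlgHom.toLinearMap) _ = 0
  rw [hE, liftBaseChange_toLinearMap, map_sub, h1, hF, ptEval_tmul, one_mul, sub_eq_zero]
  exact (RepPt.lift_sumComap h ρ σ _).symm

/-- The linear left inverse in `piRepComul` was chosen arbitrarily off the image; membership in the
image makes its value the true preimage. -/
lemma IsQurve.piRepIncl_piRepComul (hA : IsQurve ℓ A) {m n N : ℕ} (h : m + n = N)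
    (x : piRep ℓ A N) : piRepIncl ℓ A m n (piRepComul ℓ A h x) = sumComap ℓ A h x := by
  obtain ⟨y, hy⟩ := hA.exists_piRepIncl_eq (AlgebraicClosure ℓ) h x
  have h1 : piRepComul ℓ A h x = y := by
    change (piRepIncl ℓ A m n).toLinearMap.leftInverse (sumComap ℓ A h x) = y
    rw [← hy]
    exact LinearMap.leftInverse_apply_of_inj
      (LinearMap.ker_eq_bot.2 (piRepIncl_injective ℓ A m n)) y
  rw [h1, hy]

end PiRep

/-! ### Mock bialgebras from separating characters -/

section MockBialgebra

variable {ℓ K B : Type*} [Field ℓ] [Field K] [Algebra ℓ K] [NonUnitalRing B] [Module ℓ B]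
  [IsScalarTower ℓ B B] [SMulCommClass ℓ B B]

lemma tmulFun_mul {χ ψ : B →ₗ[ℓ] K} (hχ : ∀ x y, χ (x * y) = χ x * χ y)
    (hψ : ∀ x y, ψ (x * y) = ψ x * ψ y) (z w : B ⊗[ℓ] B) :
    tmulFun χ ψ (z * w) = tmulFun χ ψ z * tmulFun χ ψ w := by
  induction z with
  | zero => simp
  | add a b ha hb => rw [add_mul, map_add, map_add, ha, hb, add_mul]
  | tmul a b =>
    induction w with
    | zero => simp
    | add c d hc hd => rw [mul_add, map_add, map_add, hc, hd, mul_add]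
    | tmul c d => simp [hχ, hψ]; ring

lemma tmulFun_assoc {U V W : Type*} [AddCommGroup U] [Module ℓ U] [AddCommGroup V] [Module ℓ V]
    [AddCommGroup W] [Module ℓ W] (χ : U →ₗ[ℓ] K) (ψ : V →ₗ[ℓ] K) (φ : W →ₗ[ℓ] K)
    (z : (U ⊗[ℓ] V) ⊗[ℓ] W) :
    tmulFun χ (tmulFun ψ φ) (TensorProduct.assoc ℓ U V W z) = tmulFun (tmulFun χ ψ) φ z := by
  induction z with
  | zero => simp
  | add a b ha hb => simp only [map_add, ha, hb]
  | tmul a b =>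
    induction a with
    | zero => simp
    | add c d hc hd => simp only [map_add, TensorProduct.add_tmul, hc, hd]
    | tmul c d => simp [mul_assoc]

lemma tmulFun_map {U V U' V' : Type*} [AddCommGroup U] [Module ℓ U] [AddCommGroup V] [Module ℓ V]
    [AddCommGroup U'] [Module ℓ U'] [AddCommGroup V'] [Module ℓ V'] (χ : U' →ₗ[ℓ] K)
    (ψ : V' →ₗ[ℓ] K) (f : U →ₗ[ℓ] U') (g : V →ₗ[ℓ] V') (z : U ⊗[ℓ] V) :
    tmulFun χ ψ (TensorProduct.map f g z) = tmulFun (χ ∘ₗ f) (ψ ∘ₗ g) z := by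
  induction z with
  | zero => simp
  | add a b ha hb => simp only [map_add, ha, hb]
  | tmul a b => simp

/-- A separating monoid of multiplicative functionals, closed under convolution, makes its domain
a mock bialgebra. -/
lemma IsMockBialgebra.of_separates [CoalgebraStruct ℓ B] {G : Type*} [AddMonoid G]
    {χ : G → B →ₗ[ℓ] K} (hχ : Separates χ) (hmul : ∀ g x y, χ g (x * y) = χ g x * χ g y)
    (hcomul : ∀ g h x, tmulFun (χ g) (χ h) (CoalgebraStruct.comul x) = χ (g + h) x)
    (hcounit : ∀ x, algebraMap ℓ K (CoalgebraStruct.counit x) = χ 0 x) :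
    IsMockBialgebra ℓ B where
  coassoc := by
    ext x
    -- Against `χ a ⊗ χ b ⊗ χ c`, the two sides are `χ` at the two bracketings of `a + b + c`.
    refine (hχ.tmul (hχ.tmul hχ)).ext fun ⟨a, b, c⟩ ↦ ?_
    have h1 : tmulFun (χ a) (χ b) ∘ₗ CoalgebraStruct.comul = χ (a + b) :=
      LinearMap.ext (hcomul a b)
    have h2 : tmulFun (χ b) (χ c) ∘ₗ CoalgebraStruct.comul = χ (b + c) :=
      LinearMap.ext (hcomul b c)
    simp only [LinearMap.comp_apply, LinearEquiv.coe_coe, tmulFun_assoc, LinearMap.rTensor,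
      LinearMap.lTensor, tmulFun_map, h1, h2, LinearMap.comp_id, hcomul, add_assoc]
  rTensor_counit_comp_comul := by
    ext x
    apply (TensorProduct.lid ℓ B).injective
    refine hχ.ext fun g ↦ ?_
    have h1 (z : B ⊗[ℓ] B) : χ g (TensorProduct.lid ℓ B (CoalgebraStruct.counit.rTensor B z)) =
        tmulFun (χ 0) (χ g) z := by
      induction z with
      | zero => simp
      | add a b ha hb => simp only [map_add, ha, hb]
      | tmul a b => simp [← hcounit, Algebra.smul_def]
    simp [h1, hcomul]
  lTensor_counit_comp_comul := by
    ext x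
    apply (TensorProduct.rid ℓ B).injective
    refine hχ.ext fun g ↦ ?_
    have h1 (z : B ⊗[ℓ] B) : χ g (TensorProduct.rid ℓ B (CoalgebraStruct.counit.lTensor B z)) =
        tmulFun (χ g) (χ 0) z := by
      induction z with
      | zero => simp
      | add a b ha hb => simp only [map_add, ha, hb]
      | tmul a b => simp [← hcounit, Algebra.smul_def, mul_comm]
    simp [h1, hcomul]
  comul_mul x y := by
    refine (hχ.tmul hχ).ext fun ⟨g, h⟩ ↦ ?_
    simp only [tmulFun_mul (hmul g) (hmul h), hcomul, hmul]
  counit_mul x y := by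
    apply (algebraMap ℓ K).injective
    rw [(algebraMap ℓ K).map_mul, hcounit, hcounit, hcounit, hmul]

end MockBialgebra

/-! ### The mock bialgebra of functions on a monoid -/

section Func

variable {k : Type u} {G : Type v} [Field k]

variable (k) in
/-- Evaluation at a point. -/
def Func.eval (g : G) : Func k G →ₗ[k] k := Finsupp.lapply g

@[simp] lemma Func.eval_apply (g : G) (f : Func k G) : Func.eval k g f = f g := rfl

lemma Func.separates : Separates (Func.eval k : G → Func k G →ₗ[k] k) :=
  separates_of_eq_zero fun _ h ↦ DFunLike.ext (F := G →₀ k) _ _ h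

lemma Func.induction {P : Func k G → Prop} (f : Func k G) (h0 : P 0)
    (hadd : ∀ f₁ f₂, P f₁ → P f₂ → P (f₁ + f₂)) (hsmul : ∀ (c : k) g, P (c • Func.x k g)) : P f := by
  refine Finsupp.induction_linear (motive := P) f h0 hadd fun g c ↦ ?_
  have : (Finsupp.single g c : G →₀ k) = c • Func.x k g := by
    change _ = c • (Finsupp.single g 1 : G →₀ k)
    simp
  rw [this]
  exact hsmul c g

lemma Func.x_apply [DecidableEq G] (g h : G) : Func.x k g h = if g = h then 1 else 0 :=
  Finsupp.single_apply

variable [AddMonoid G]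

lemma Func.counit_apply (f : Func k G) : CoalgebraStruct.counit (R := k) f = f 0 := rfl

lemma Func.comul_x (g : G) : CoalgebraStruct.comul (R := k) (Func.x k g) =
    ∑ᶠ p : {p : G × G // p.1 + p.2 = g}, Func.x k p.1.1 ⊗ₜ[k] Func.x k p.1.2 := by
  change Finsupp.linearCombination k _ (Finsupp.single g 1) = _
  rw [Finsupp.linearCombination_single, one_smul]

lemma Func.tmulFun_comul (hG : ∀ γ : G, {p : G × G | p.1 + p.2 = γ}.Finite) (g h : G)
    (f : Func k G) :
    tmulFun (Func.eval k g) (Func.eval k h) (CoalgebraStruct.comul f) = Func.eval k (g + h) f := by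
  classical
  induction f using Func.induction with
  | h0 => simp only [map_zero]
  | hadd f₁ f₂ h₁ h₂ => simp only [map_add, h₁, h₂]
  | hsmul c γ =>
    -- Finiteness turns the `finsum` in the comultiplication into a genuine sum; with infinitely
    -- many decompositions it would take the default value `0`.
    have : Fintype {p : G × G // p.1 + p.2 = γ} := (hG γ).fintype
    rw [map_smul, map_smul, map_smul, Func.comul_x, finsum_eq_sum_of_fintype, map_sum]
    congr 1
    simp only [tmulFun_tmul, Func.eval_apply, Func.x_apply]
    by_cases hγ : γ = g + h
    · rw [if_pos hγ, Finset.sum_eq_single ⟨(g, h), hγ.symm⟩]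
      · simp
      · rintro ⟨⟨a, b⟩, hab⟩ _ hne
        by_cases h1 : a = g
        · by_cases h2 : b = h
          · subst h1 h2; exact absurd rfl hne
          · simp [h2]
        · simp [h1]
      · simp
    · rw [if_neg hγ]
      refine Finset.sum_eq_zero fun p _ ↦ ?_
      by_cases h1 : p.1.1 = g
      · by_cases h2 : p.1.2 = h
        · exact absurd (by rw [← h1, ← h2, p.2]) hγ
        · simp [h2]
      · simp [h1]

lemma Func.isMockBialgebra (hG : ∀ γ : G, {p : G × G | p.1 + p.2 = γ}.Finite) :
    IsMockBialgebra k (Func k G) :=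
  .of_separates Func.separates (fun g x y ↦ Func.mul_apply k G x y g) (Func.tmulFun_comul hG)
    fun _ ↦ rfl

end Func

/-! ### Characters of `coco(A)` -/

section Characters

variable {ℓ : Type u} {A : Type v} [Field ℓ] [Ring A] [Algebra ℓ A]
  {K : Type w} [Field K] [Algebra ℓ K]

/-- Summands have dimension at most that of `γ`, and each dimension has finitely many components. -/
lemma IsQurve.finite_add_eq (hA : IsQurve ℓ A) (γ : Comp K (K ⊗[ℓ] A)) :
    {p : Comp K (K ⊗[ℓ] A) × Comp K (K ⊗[ℓ] A) | p.1 + p.2 = γ}.Finite := by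
  have hfin : {g : Comp K (K ⊗[ℓ] A) | g.1 ≤ γ.1}.Finite := by
    refine ((Set.finite_Iic γ.1).biUnion fun n _ ↦ ?_ :
      (⋃ n ∈ Set.Iic γ.1, Set.range (Sigma.mk n) : Set (Comp K (K ⊗[ℓ] A))).Finite).subset ?_
    · have := hA.finite_components (K := K) n
      exact Set.finite_range _
    · rintro ⟨n, y⟩ h
      exact Set.mem_biUnion (show n ∈ Set.Iic γ.1 from h) ⟨y, rfl⟩
  refine (hfin.prod hfin).subset ?_
  rintro ⟨a, b⟩ rfl
  exact ⟨Nat.le_add_right a.1 b.1, Nat.le_add_left b.1 a.1⟩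

lemma Coco.proj_of_self (n : ℕ) (c : piRep ℓ A n) : proj ℓ A n (of ℓ A n c) = c :=
  DirectSum.component.lof_self (M := fun n ↦ piRep ℓ A n) ℓ n c

lemma Coco.proj_of_ne {m n : ℕ} (h : m ≠ n) (c : piRep ℓ A m) : proj ℓ A n (of ℓ A m c) = 0 :=
  DirectSum.component.of (M := fun n ↦ piRep ℓ A n) ℓ n m c |>.trans (dif_neg h)

lemma Coco.induction {P : Coco ℓ A → Prop} (x : Coco ℓ A) (h0 : P 0)
    (hadd : ∀ x y, P x → P y → P (x + y)) (hof : ∀ n c, P (of ℓ A n c)) : P x :=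
  DirectSum.induction_on (motive := P) x h0 hof hadd

lemma Coco.eq_zero_of_lTensor_proj {x : K ⊗[ℓ] Coco ℓ A}
    (h : ∀ n, (proj ℓ A n).lTensor K x = 0) : x = 0 := by
  classical
  let b := Module.Basis.ofVectorSpace ℓ K
  apply (TensorProduct.equivFinsuppOfBasisLeft (N := Coco ℓ A) b).injective
  ext j : 1
  rw [map_zero, Finsupp.zero_apply]
  refine Coco.ext fun n ↦ ?_
  have h₂ := DFunLike.congr_fun (congrArg
    (TensorProduct.equivFinsuppOfBasisLeft (N := piRep ℓ A n) b) (h n)) j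
  rw [map_zero, Finsupp.zero_apply] at h₂
  rw [map_zero, ← h₂]
  generalize x = x
  induction x with
  | zero => simp
  | add a b ha hb => simp only [map_add, Finsupp.add_apply, ha, hb]
  | tmul a b => simp [TensorProduct.equivFinsuppOfBasisLeft_apply_tmul]

variable [IsAlgClosed K] [Algebra.IsAlgebraic ℓ K] (hA : IsQurve ℓ A)

variable (K) in
/-- The character of `coco(A)` given by evaluation at a component. -/
def Coco.char (g : Comp K (K ⊗[ℓ] A)) : Coco ℓ A →ₗ[ℓ] K :=
  ((LinearMap.proj g.2 ∘ₗ (piRepValues K hA g.1).toLinearMap).restrictScalars ℓ) ∘ₗ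
    TensorProduct.mk ℓ K (piRep ℓ A g.1) 1 ∘ₗ proj ℓ A g.1

lemma Coco.char_apply (g : Comp K (K ⊗[ℓ] A)) (x : Coco ℓ A) :
    char K hA g x = piRepValues K hA g.1 (1 ⊗ₜ proj ℓ A g.1 x) g.2 := rfl

lemma Coco.char_of {n : ℕ} (ρ : RepPt K (K ⊗[ℓ] A) n) (x : Coco ℓ A) :
    char K hA (Comp.of ρ) x = ρ.toAlgHom (proj ℓ A n x : RepRing ℓ A n) := by
  rw [char_apply]
  exact (piRepValues_apply hA _ ρ).trans ((ptEval_tmul _ _ _).trans (one_mul _))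

lemma Coco.char_mul (g : Comp K (K ⊗[ℓ] A)) (x y : Coco ℓ A) :
    char K hA g (x * y) = char K hA g x * char K hA g y := by
  obtain ⟨n, ρ, rfl⟩ := g.exists_of
  rw [char_of, char_of, char_of, proj_mul, MulMemClass.coe_mul, map_mul]

lemma Coco.algebraMap_counit (x : Coco ℓ A) :
    algebraMap ℓ K (CoalgebraStruct.counit x) = char K hA 0 x := by
  change algebraMap ℓ K (RepRing.lift (zeroRep ℓ A ℓ) (proj ℓ A 0 x : RepRing ℓ A 0)) =
    char K hA (Comp.of (zeroRep K (K ⊗[ℓ] A) K : RepPt K (K ⊗[ℓ] A) 0)) x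
  rw [char_of]
  have : (Algebra.ofId ℓ K).comp (RepRing.lift (zeroRep ℓ A ℓ)) =
      (RepPt.toAlgHom (zeroRep K (K ⊗[ℓ] A) K : RepPt K (K ⊗[ℓ] A) 0)) :=
    RepRing.algHom_ext fun _ i ↦ i.elim0
  exact DFunLike.congr_fun this _

lemma Coco.comul_of (N : ℕ) (c : piRep ℓ A N) : CoalgebraStruct.comul (of ℓ A N c) =
    ∑ p : Finset.HasAntidiagonal.antidiagonal N,
      TensorProduct.map (of ℓ A p.1.1) (of ℓ A p.1.2)
        (piRepComul ℓ A (Finset.HasAntidiagonal.mem_antidiagonal.1 p.2) c) := by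
  change DirectSum.toModule ℓ ℕ _ _ (DirectSum.lof ℓ ℕ (fun n ↦ piRep ℓ A n) N c) = _
  rw [DirectSum.toModule_lof]
  simp

lemma Coco.char_of_comp_of {n : ℕ} (ρ : RepPt K (K ⊗[ℓ] A) n) :
    char K hA (Comp.of ρ) ∘ₗ of ℓ A n = (ρ.toAlgHom.comp (piRep ℓ A n).val).toLinearMap := by
  refine LinearMap.ext fun c ↦ ?_
  rw [LinearMap.comp_apply, char_of, proj_of_self]
  rfl

lemma Coco.char_of_comp_of_ne {m n : ℕ} (h : m ≠ n) (ρ : RepPt K (K ⊗[ℓ] A) n) :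
    char K hA (Comp.of ρ) ∘ₗ of ℓ A m = 0 := by
  refine LinearMap.ext fun c ↦ ?_
  rw [LinearMap.comp_apply, char_of, proj_of_ne h, ZeroMemClass.coe_zero, map_zero,
    LinearMap.zero_apply]

/-- Characters in dimensions `m` and `n` see only the term `Δ_{m,n}`, which is the comorphism of the
sum map; evaluating it at `(ρ, σ)` is evaluating at `ρ ⊕ σ`. If `m + n ≠ N`, both sides vanish on
`π₀(N)`. -/
lemma Coco.tmulFun_comul (g h : Comp K (K ⊗[ℓ] A)) (x : Coco ℓ A) :
    tmulFun (char K hA g) (char K hA h) (CoalgebraStruct.comul x) = char K hA (g + h) x := by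
  obtain ⟨m, ρ, rfl⟩ := g.exists_of
  obtain ⟨n, σ, rfl⟩ := h.exists_of
  induction x using Coco.induction with
  | h0 => simp only [map_zero]
  | hadd x y hx hy => simp only [map_add, hx, hy]
  | hof N c =>
    have hzero {U V : Type _} [AddCommGroup U] [Module ℓ U] [AddCommGroup V] [Module ℓ V]
        (χ : U →ₗ[ℓ] K) (z : U ⊗[ℓ] V) :
        tmulFun χ (0 : V →ₗ[ℓ] K) z = 0 := by simp [tmulFun]
    have hzero' {U V : Type _} [AddCommGroup U] [Module ℓ U] [AddCommGroup V] [Module ℓ V]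
        (χ : V →ₗ[ℓ] K) (z : U ⊗[ℓ] V) :
        tmulFun (0 : U →ₗ[ℓ] K) χ z = 0 := by simp [tmulFun]
    rw [comul_of, map_sum]
    simp only [tmulFun_map]
    by_cases hN : m + n = N
    · rw [Comp.of_add_of hN, char_of, proj_of_self,
        Finset.sum_eq_single ⟨(m, n), Finset.HasAntidiagonal.mem_antidiagonal.2 hN⟩]
      · rw [char_of_comp_of, char_of_comp_of, ← RepPt.lift_sumComap, ← hA.piRepIncl_piRepComul]
        generalize piRepComul ℓ A _ c = z
        induction z with
        | zero => simp only [map_zero]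
        | add a b ha hb => simp only [map_add, ha, hb]
        | tmul a b => simp [piRepIncl]
      · rintro ⟨⟨a, b⟩, hab⟩ _ hne
        by_cases h1 : a = m
        · by_cases h2 : b = n
          · subst h1 h2; exact absurd rfl hne
          · rw [char_of_comp_of_ne hA h2, hzero]
        · rw [char_of_comp_of_ne hA h1, hzero']
      · simp
    · rw [Comp.of_add_of rfl, char_of, proj_of_ne (Ne.symm hN), ZeroMemClass.coe_zero, map_zero]
      refine Finset.sum_eq_zero ?_
      rintro ⟨⟨a, b⟩, hab⟩ _
      by_cases h1 : a = m
      · by_cases h2 : b = n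
        · subst h1 h2; exact absurd (Finset.HasAntidiagonal.mem_antidiagonal.1 hab) hN
        · rw [char_of_comp_of_ne hA h2, hzero]
      · rw [char_of_comp_of_ne hA h1, hzero']

lemma Coco.liftBaseChange_char (g : Comp K (K ⊗[ℓ] A)) (x : K ⊗[ℓ] Coco ℓ A) :
    (char K hA g).liftBaseChange K x =
      piRepValues K hA g.1 ((proj ℓ A g.1).lTensor K x) g.2 := by
  induction x with
  | zero => simp
  | add a b ha hb => simp only [map_add, ha, hb, Pi.add_apply]
  | tmul a b =>
    rw [LinearMap.liftBaseChange_tmul, char_apply, LinearMap.lTensor_tmul]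
    conv_rhs => rw [← mul_one a, ← smul_eq_mul, ← TensorProduct.smul_tmul', map_smul]
    rfl

lemma Coco.separates : Separates (char K hA) := by
  intro x hx
  refine eq_zero_of_lTensor_proj (K := K) fun n ↦ (piRepValues K hA n).injective ?_
  rw [map_zero]
  ext y
  exact (liftBaseChange_char hA ⟨n, y⟩ x).symm.trans (hx ⟨n, y⟩)

lemma IsQurve.isMockBialgebra_coco (hA : IsQurve ℓ A) : IsMockBialgebra ℓ (Coco ℓ A) :=
  .of_separates (Coco.separates (K := AlgebraicClosure ℓ) hA) (Coco.char_mul hA)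
    (Coco.tmulFun_comul hA) (Coco.algebraMap_counit hA)

end Characters

/-! ### Galois descent over a possibly imperfect field -/

section Descent

variable {ℓ K : Type*} [Field ℓ] [Field K] [Algebra ℓ K]

/-- Separable elements fixed by all automorphisms of an algebraic closure lie in the base field. -/
lemma mem_range_algebraMap_of_fixed [IsAlgClosed K] [Algebra.IsAlgebraic ℓ K] {x : K}
    (hs : IsSeparable ℓ x) (hx : ∀ σ : K ≃ₐ[ℓ] K, σ x = x) : ∃ c, algebraMap ℓ K c = x := by
  have : IsAlgClosure ℓ K := ⟨inferInstance, inferInstance⟩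
  have : Normal ℓ K := IsAlgClosure.normal ℓ K
  by_contra hne
  have hbot : x ∉ (⊥ : Subalgebra ℓ K) := fun h ↦ hne (Algebra.mem_bot.1 h)
  obtain ⟨y, hy, hxy⟩ := (notMem_iff_exists_ne_and_isConjRoot hs (Normal.splits this x)).1 hbot
  obtain ⟨σ, hσ⟩ := isConjRoot_iff_exists_algEquiv.1 hxy
  exact hy (σ.injective ((hx σ).trans hσ.symm))

/-- An element of `K ⊗ V` fixed by a retraction onto the separable elements and by all
automorphisms of `K` comes from `V`. -/
lemma exists_one_tmul_of_fixed [IsAlgClosed K] [Algebra.IsAlgebraic ℓ K] {V : Type*}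
    [AddCommGroup V] [Module ℓ V] {z : K ⊗[ℓ] V} {r : K →ₗ[ℓ] K} (hr : ∀ a, IsSeparable ℓ (r a))
    (hrz : r.rTensor V z = z)
    (hσ : ∀ σ : K ≃ₐ[ℓ] K, σ.toLinearMap.rTensor V z = z) : ∃ v, (1 : K) ⊗ₜ[ℓ] v = z := by
  classical
  let b := Module.Basis.ofVectorSpace ℓ V
  let E := TensorProduct.equivFinsuppOfBasisRight (M := K) b
  have hE (f : K →ₗ[ℓ] K) (j) : E (f.rTensor V z) j = f (E z j) := by
    generalize z = z
    induction z with
    | zero => simp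
    | add a b ha hb => simp only [map_add, Finsupp.add_apply, ha, hb]
    | tmul a b => simp [E, TensorProduct.equivFinsuppOfBasisRight_apply_tmul]
  -- The coordinates of `z` in a basis of `V` are fixed by `r`, hence separable, and fixed by all
  -- automorphisms, hence in `ℓ`.
  have hc (j) : ∃ c, algebraMap ℓ K c = E z j := by
    refine mem_range_algebraMap_of_fixed ?_ fun σ ↦ ?_
    · rw [← hrz, hE]
      exact hr _
    · exact (hE σ.toLinearMap j).symm.trans (by rw [hσ])
  choose c hc using hc
  have hz : z = (E z).sum fun i m ↦ m ⊗ₜ b i := by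
    conv_lhs => rw [← E.symm_apply_apply z]
    exact TensorProduct.equivFinsuppOfBasisRight_symm_apply b _
  refine ⟨(E z).sum fun i _ ↦ c i • b i, ?_⟩
  conv_rhs => rw [hz]
  rw [Finsupp.sum, Finsupp.sum, TensorProduct.tmul_sum]
  refine Finset.sum_congr rfl fun i _ ↦ ?_
  rw [← hc, Algebra.algebraMap_eq_smul_one, TensorProduct.smul_tmul]

-- A projection of `K` onto the separable closure of `ℓ` in `K`, linear over that closure. Being
-- fixed by `r` encodes separability as a linear condition that can be transported to `K ⊗ V`.
variable (ℓ K) in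
lemma exists_separable_retraction : ∃ r : K →ₗ[ℓ] K, (∀ a, IsSeparable ℓ (r a)) ∧
    (∀ c, IsSeparable ℓ c → ∀ a, r (a * c) = r a * c) ∧ ∀ c, IsSeparable ℓ c → r c = c := by
  obtain ⟨r, hr⟩ := (Algebra.linearMap (separableClosure ℓ K) K).exists_leftInverse_of_injective
    (LinearMap.ker_eq_bot.2 (algebraMap (separableClosure ℓ K) K).injective)
  have hr1 : r 1 = 1 := by simpa using LinearMap.congr_fun hr 1
  have hmul (c : K) (hc : IsSeparable ℓ c) (a : K) : (r (a * c) : K) = r a * c := by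
    have : a * c = (⟨c, mem_separableClosure_iff.2 hc⟩ : separableClosure ℓ K) • a := by
      rw [mul_comm]; rfl
    rw [this, map_smul, mul_comm]
    rfl
  refine ⟨(separableClosure ℓ K).val.toLinearMap ∘ₗ r.restrictScalars ℓ,
    fun a ↦ mem_separableClosure_iff.1 (r a).2, fun c hc a ↦ hmul c hc a, fun c hc ↦ ?_⟩
  have := hmul c hc 1
  rwa [hr1, one_mul, OneMemClass.coe_one, one_mul] at this

end Descent

/-! ### The isomorphism with functions on components -/

section Isomorphism

variable {ℓ : Type u} {A : Type v} [Field ℓ] [Ring A] [Algebra ℓ A]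
  {K : Type w} [Field K] [Algebra ℓ K]

lemma Coco.liftBaseChange_mul {ψ : Coco ℓ A →ₗ[ℓ] K} (hψ : ∀ x y, ψ (x * y) = ψ x * ψ y)
    (z w : K ⊗[ℓ] Coco ℓ A) :
    ψ.liftBaseChange K (z * w) = ψ.liftBaseChange K z * ψ.liftBaseChange K w := by
  induction z with
  | zero => simp
  | add a b ha hb => rw [add_mul, map_add, map_add, ha, hb, add_mul]
  | tmul a b =>
    induction w with
    | zero => simp
    | add c d hc hd => rw [mul_add, map_add, map_add, hc, hd, mul_add]
    | tmul c d =>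
      rw [Algebra.TensorProduct.tmul_mul_tmul]
      simp only [LinearMap.liftBaseChange_tmul, smul_eq_mul, hψ]
      ring

/-- `σ⁻¹ ⊗ 1` fixes `1 ⊗ a`, so on matrix entries of `A` only the outer `σ` remains. -/
lemma RepPt.toAlgHom_gal {n : ℕ} (σ : K ≃ₐ[ℓ] K) (ρ : RepPt K (K ⊗[ℓ] A) n)
    (c : RepRing ℓ A n) : (RepPt.gal σ ρ).toAlgHom c = σ (ρ.toAlgHom c) := by
  suffices (RepPt.gal σ ρ).toAlgHom = σ.toAlgHom.comp ρ.toAlgHom from DFunLike.congr_fun this c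
  refine RepRing.algHom_ext fun a i j ↦ ?_
  rw [AlgHom.comp_apply, toAlgHom_coord, toAlgHom_coord, gal_apply, Algebra.TensorProduct.map_tmul,
    map_one]
  rfl

variable [IsAlgClosed K] [Algebra.IsAlgebraic ℓ K] (hA : IsQurve ℓ A)

namespace Coco

/-- An element of `π₀(n)` is supported on the finitely many components of dimension `n`. -/
lemma finite_support_char (z : K ⊗[ℓ] Coco ℓ A) :
    (Function.support fun g ↦ (char K hA g).liftBaseChange K z).Finite := by
  induction z with
  | zero => simp
  | add z w hz hw =>
    refine (hz.union hw).subset fun g hg ↦ ?_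
    contrapose! hg
    simp only [Set.mem_union, Function.mem_support, not_or, not_not] at hg ⊢
    rw [map_add, hg.1, hg.2, add_zero]
  | tmul a x =>
    induction x using Coco.induction with
    | h0 => simp
    | hadd x y hx hy =>
      refine (hx.union hy).subset fun g hg ↦ ?_
      contrapose! hg
      simp only [Set.mem_union, Function.mem_support, not_or, not_not] at hg ⊢
      rw [TensorProduct.tmul_add, map_add, hg.1, hg.2, add_zero]
    | hof n c =>
      have := hA.finite_components (K := K) n
      refine (Set.finite_range (Sigma.mk n : _ → Comp K (K ⊗[ℓ] A))).subset fun g hg ↦ ?_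
      obtain ⟨m, ρ, rfl⟩ := Comp.exists_of g
      by_cases h : n = m
      · subst h; exact ⟨_, rfl⟩
      · refine absurd ?_ hg
        dsimp only
        rw [LinearMap.liftBaseChange_tmul, char_of, proj_of_ne h, ZeroMemClass.coe_zero, map_zero,
          smul_zero]

/-- Elements of `coco(A) ⊗ K` as functions on the component semigroup. -/
def toFunc : K ⊗[ℓ] Coco ℓ A →ₗ[K] Func K (Comp K (K ⊗[ℓ] A)) where
  toFun z := Finsupp.ofSupportFinite _ (finite_support_char hA z)
  map_add' z w := DFunLike.ext (F := Comp K (K ⊗[ℓ] A) →₀ K) _ _ fun g ↦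
    map_add ((char K hA g).liftBaseChange K) z w
  map_smul' a z := DFunLike.ext (F := Comp K (K ⊗[ℓ] A) →₀ K) _ _ fun g ↦
    map_smul ((char K hA g).liftBaseChange K) a z

lemma toFunc_apply (z : K ⊗[ℓ] Coco ℓ A) (g : Comp K (K ⊗[ℓ] A)) :
    toFunc hA z g = (char K hA g).liftBaseChange K z := rfl

lemma toFunc_one_tmul_apply (x : Coco ℓ A) (g : Comp K (K ⊗[ℓ] A)) :
    toFunc hA (1 ⊗ₜ x) g = char K hA g x := by
  rw [toFunc_apply, LinearMap.liftBaseChange_tmul, one_smul]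

lemma toFunc_injective : Function.Injective (toFunc (K := K) hA) := by
  rw [← LinearMap.ker_eq_bot, LinearMap.ker_eq_bot']
  intro z hz
  refine separates hA z fun g ↦ ?_
  rw [← toFunc_apply, hz]
  rfl

/-- The indicator of a component of `rep_n` comes from degree `n`, through the inverse of
`piRepValues`. -/
lemma toFunc_surjective : Function.Surjective (toFunc (K := K) hA) := by
  classical
  intro f
  induction f using Func.induction with
  | h0 => exact ⟨0, map_zero _⟩
  | hadd f₁ f₂ h₁ h₂ =>
    obtain ⟨z₁, rfl⟩ := h₁
    obtain ⟨z₂, rfl⟩ := h₂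
    exact ⟨z₁ + z₂, map_add _ _ _⟩
  | hsmul a g =>
    obtain ⟨n, y⟩ := g
    refine ⟨a • (of ℓ A n).lTensor K ((piRepValues K hA n).symm (Pi.single y 1)), ?_⟩
    rw [map_smul]
    congr 1
    refine DFunLike.ext (F := Comp K (K ⊗[ℓ] A) →₀ K) _ _ fun ⟨m, y'⟩ ↦ ?_
    refine (liftBaseChange_char hA ⟨m, y'⟩ _).trans ?_
    refine Eq.trans ?_ (Func.x_apply (k := K) _ _).symm
    rw [← LinearMap.comp_apply, ← LinearMap.lTensor_comp]
    by_cases h : n = m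
    · subst h
      have : proj ℓ A n ∘ₗ of ℓ A n = LinearMap.id := LinearMap.ext (proj_of_self n)
      rw [this, LinearMap.lTensor_id, LinearMap.id_apply, AlgEquiv.apply_symm_apply,
        Pi.single_apply]
      refine if_congr ?_ rfl rfl
      constructor
      · rintro rfl; rfl
      · intro h; exact (eq_of_heq (Sigma.mk.inj h).2).symm
    · have : proj ℓ A m ∘ₗ of ℓ A n = 0 := LinearMap.ext (proj_of_ne h)
      rw [this, LinearMap.lTensor_zero, LinearMap.zero_apply, map_zero, if_neg]
      · rfl
      · intro h'; exact h (Sigma.mk.inj h').1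

lemma toFunc_mul (z w : K ⊗[ℓ] Coco ℓ A) : toFunc hA (z * w) = toFunc hA z * toFunc hA w :=
  DFunLike.ext (F := Comp K (K ⊗[ℓ] A) →₀ K) _ _ fun g ↦ liftBaseChange_mul (char_mul hA g) z w

lemma counit_toFunc (z : K ⊗[ℓ] Coco ℓ A) :
    CoalgebraStruct.counit (R := K) (toFunc hA z) = CoalgebraStruct.counit (R := K) z := by
  induction z with
  | zero => simp only [map_zero]
  | add a b ha hb => simp only [map_add, ha, hb]
  | tmul a x =>
    rw [Func.counit_apply, toFunc_apply, LinearMap.liftBaseChange_tmul, ← algebraMap_counit,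
      TensorProduct.counit_tmul, CommSemiring.counit_apply, smul_eq_mul, Algebra.smul_def, mul_comm]

/-- Tested against evaluation at `(g, h)`, both sides give the value at `g + h`. -/
lemma comul_toFunc (z : K ⊗[ℓ] Coco ℓ A) :
    TensorProduct.map (toFunc hA) (toFunc hA) (CoalgebraStruct.comul (R := K) z) =
      CoalgebraStruct.comul (R := K) (toFunc hA z) := by
  refine (Func.separates.tmul Func.separates).ext fun ⟨g, h⟩ ↦ ?_
  dsimp only
  rw [Func.tmulFun_comul hA.finite_add_eq, tmulFun_map]
  induction z with
  | zero => simp only [map_zero]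
  | add a b ha hb => simp only [map_add, ha, hb]
  | tmul a x =>
    rw [TensorProduct.comul_tmul, CommSemiring.comul_apply, Func.eval_apply, toFunc_apply,
      LinearMap.liftBaseChange_tmul, ← tmulFun_comul]
    generalize CoalgebraStruct.comul (R := ℓ) x = t
    induction t with
    | zero => simp
    | add b c hb hc => simp only [TensorProduct.tmul_add, map_add, hb, hc, smul_add]
    | tmul b c =>
      rw [TensorProduct.AlgebraTensorModule.tensorTensorTensorComm_tmul, tmulFun_tmul,
        tmulFun_tmul]
      simp only [LinearMap.comp_apply, Func.eval_apply, toFunc_apply,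
        LinearMap.liftBaseChange_tmul, smul_eq_mul]
      ring

/-- The isomorphism of `coco(A) ⊗ K` with the functions on the component semigroup. -/
def funcEquiv : (K ⊗[ℓ] Coco ℓ A) ≃ₗc[K] Func K (Comp K (K ⊗[ℓ] A)) :=
  { LinearEquiv.ofBijective (toFunc hA) ⟨toFunc_injective hA, toFunc_surjective hA⟩ with
    counit_comp := LinearMap.ext (counit_toFunc hA)
    map_comp_comul := LinearMap.ext (comul_toFunc hA) }

end Coco

/-! ### `coco(A)` as invariant functions -/

section GaloisDescent

namespace Coco

lemma char_smul (σ : K ≃ₐ[ℓ] K) (g : Comp K (K ⊗[ℓ] A)) (x : Coco ℓ A) :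
    char K hA (σ • g) x = σ (char K hA g x) := by
  obtain ⟨n, ρ, rfl⟩ := g.exists_of
  rw [Comp.smul_of, char_of, char_of, RepPt.toAlgHom_gal]

lemma isSeparable_char (g : Comp K (K ⊗[ℓ] A)) (x : Coco ℓ A) : IsSeparable ℓ (char K hA g x) := by
  obtain ⟨n, ρ, rfl⟩ := g.exists_of
  rw [char_of]
  exact (hA.isGreatest_piRep n).1.isSeparable (ρ.toAlgHom.comp (piRep ℓ A n).val) _

lemma liftBaseChange_char_smul (σ : K ≃ₐ[ℓ] K) (g : Comp K (K ⊗[ℓ] A)) (z : K ⊗[ℓ] Coco ℓ A) :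
    (char K hA (σ • g)).liftBaseChange K (σ.toLinearMap.rTensor _ z) =
      σ ((char K hA g).liftBaseChange K z) := by
  induction z with
  | zero => simp
  | add a b ha hb => simp only [map_add, ha, hb]
  | tmul a x => simp [char_smul]

/-- Galois descent for `coco(A)`. -/
lemma range_toFunc_one_tmul : Set.range (fun x : Coco ℓ A ↦ toFunc (K := K) hA (1 ⊗ₜ x)) =
    {f | (∀ σ : K ≃ₐ[ℓ] K, Func.gal σ f = f) ∧ ∀ α, IsSeparable ℓ (f α)} := by
  ext f
  constructor
  · rintro ⟨x, rfl⟩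
    refine ⟨fun σ ↦ DFunLike.ext (F := Comp K (K ⊗[ℓ] A) →₀ K) _ _ fun g ↦ ?_, fun g ↦ ?_⟩
    · refine (Func.gal_apply σ _ g).trans ?_
      rw [toFunc_one_tmul_apply, ← char_smul, smul_inv_smul]
      exact (toFunc_one_tmul_apply hA x g).symm
    · rw [toFunc_one_tmul_apply]
      exact isSeparable_char hA g x
  · rintro ⟨hσ, hs⟩
    obtain ⟨z, rfl⟩ := toFunc_surjective hA f
    obtain ⟨r, hr, hrmul, hrs⟩ := exists_separable_retraction ℓ K
    suffices ∃ x : Coco ℓ A, (1 : K) ⊗ₜ[ℓ] x = z by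
      obtain ⟨x, rfl⟩ := this
      exact ⟨x, rfl⟩
    refine exists_one_tmul_of_fixed hr ?_ fun σ ↦ ?_
    · refine toFunc_injective hA (DFunLike.ext (F := Comp K (K ⊗[ℓ] A) →₀ K) _ _ fun g ↦ ?_)
      -- `r` passes through the characters because it is linear over separable elements and
      -- characters take separable values.
      have h1 (z : K ⊗[ℓ] Coco ℓ A) : (char K hA g).liftBaseChange K (r.rTensor _ z) =
          r ((char K hA g).liftBaseChange K z) := by
        induction z with
        | zero => simp
        | add a b ha hb => simp only [map_add, ha, hb]
        | tmul a x => simp [hrmul _ (isSeparable_char hA g x)]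
      exact (h1 z).trans (hrs _ (hs g))
    · refine toFunc_injective hA (DFunLike.ext (F := Comp K (K ⊗[ℓ] A) →₀ K) _ _ fun g ↦ ?_)
      have h1 := liftBaseChange_char_smul hA σ (σ⁻¹ • g) z
      rw [smul_inv_smul] at h1
      refine h1.trans ?_
      rw [← toFunc_apply, ← Func.gal_apply, hσ]
      rfl

end Coco

end GaloisDescent

/-! ### Recovering the component semigroup -/

section Reconstruction

namespace Coco

-- Extend `ψ` to a multiplicative functional `Ψ` on functions. As `Ψ ≠ 0`, some `Ψ(x_g)` is nonzero,
-- and `x_g f = f(g) x_g` then forces `Ψ(f) = f(g)`.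
variable (K) in
lemma exists_char_eq {ψ : Coco ℓ A →ₗ[ℓ] K} (hψ : ∀ x y, ψ (x * y) = ψ x * ψ y)
    (h0 : ψ ≠ 0) : ∃ g, char K hA g = ψ := by
  classical
  let E := LinearEquiv.ofBijective (toFunc (K := K) hA)
    ⟨toFunc_injective hA, toFunc_surjective hA⟩
  let Ψ : Func K (Comp K (K ⊗[ℓ] A)) →ₗ[K] K := ψ.liftBaseChange K ∘ₗ E.symm.toLinearMap
  have hΨ (z) : Ψ (toFunc hA z) = ψ.liftBaseChange K z := by
    change ψ.liftBaseChange K (E.symm (E z)) = _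
    rw [E.symm_apply_apply]
  have hmul (f₁ f₂) : Ψ (f₁ * f₂) = Ψ f₁ * Ψ f₂ := by
    obtain ⟨z₁, rfl⟩ := toFunc_surjective hA f₁
    obtain ⟨z₂, rfl⟩ := toFunc_surjective hA f₂
    rw [← toFunc_mul, hΨ, hΨ, hΨ, liftBaseChange_mul hψ]
  obtain ⟨g, hg⟩ : ∃ g, Ψ (Func.x K g) ≠ 0 := by
    by_contra! hne
    refine h0 (LinearMap.ext fun x ↦ ?_)
    have h1 (f) : Ψ f = 0 := by
      induction f using Func.induction with
      | h0 => exact map_zero _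
      | hadd f₁ f₂ h₁ h₂ => rw [map_add, h₁, h₂, add_zero]
      | hsmul c g => rw [map_smul, hne, smul_zero]
    have h2 := hΨ (1 ⊗ₜ x)
    rw [h1, LinearMap.liftBaseChange_tmul, one_smul] at h2
    exact h2.symm
  have hx (f : Func K (Comp K (K ⊗[ℓ] A))) : Func.x K g * f = f g • Func.x K g := by
    refine DFunLike.ext (F := Comp K (K ⊗[ℓ] A) →₀ K) _ _ fun h ↦ ?_
    change Func.x K g h * f h = f g * Func.x K g h
    rw [Func.x_apply]
    split_ifs with hgh
    · subst hgh; ring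
    · ring
  refine ⟨g, LinearMap.ext fun x ↦ ?_⟩
  have h1 : Ψ (toFunc hA (1 ⊗ₜ x)) = toFunc hA (1 ⊗ₜ x) g := by
    have := hmul (Func.x K g) (toFunc hA (1 ⊗ₜ x))
    rw [hx, map_smul, smul_eq_mul, mul_comm] at this
    exact (mul_left_cancel₀ hg this).symm
  rw [hΨ, toFunc_one_tmul_apply, LinearMap.liftBaseChange_tmul, one_smul] at h1
  exact h1.symm

lemma char_injective : Function.Injective (char K hA) := by
  classical
  intro g h hgh
  obtain ⟨z, hz⟩ := toFunc_surjective hA (Func.x K g)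
  have h1 := toFunc_apply hA z h
  rw [← hgh, ← toFunc_apply, hz, Func.x_apply, Func.x_apply, if_pos rfl] at h1
  by_contra hne
  rw [if_neg hne] at h1
  exact zero_ne_one h1

lemma char_ne_zero (g : Comp K (K ⊗[ℓ] A)) : char K hA g ≠ 0 := by
  classical
  intro h0
  obtain ⟨z, hz⟩ := toFunc_surjective hA (Func.x K g)
  have h1 := toFunc_apply hA z g
  rw [h0, hz, Func.x_apply, if_pos rfl] at h1
  refine one_ne_zero (h1.trans ?_)
  induction z with
  | zero => simp
  | add a b _ _ => simp
  | tmul a b => simp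

end Coco

variable {B : Type*} [Ring B] [Algebra ℓ B]

-- Components are the nonzero multiplicative functionals to `K`, and their sum is convolution; an
-- isomorphism of mock bialgebras transports both.
variable (K) in
lemma IsQurve.nonempty_comp_addEquiv (hA : IsQurve ℓ A) (hB : IsQurve ℓ B)
    (φ : Coco ℓ A ≃ₗc[ℓ] Coco ℓ B) (hφ : ∀ x y, φ (x * y) = φ x * φ y) :
    Nonempty (Comp K (K ⊗[ℓ] A) ≃+ Comp K (K ⊗[ℓ] B)) := by
  let φl : Coco ℓ A ≃ₗ[ℓ] Coco ℓ B := φ.toLinearEquiv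
  have hφs (x y) : φl.symm (x * y) = φl.symm x * φl.symm y := by
    apply φl.injective
    rw [φl.apply_symm_apply]
    refine Eq.trans ?_ (hφ _ _).symm
    exact congrArg₂ _ (φl.apply_symm_apply x).symm (φl.apply_symm_apply y).symm
  have hex (h : Comp K (K ⊗[ℓ] B)) : ∃ g, Coco.char K hA g = Coco.char K hB h ∘ₗ φl.toLinearMap := by
    refine Coco.exists_char_eq K hA (fun x y ↦ ?_) fun h0 ↦ Coco.char_ne_zero hB h ?_
    · exact (congrArg _ (hφ x y)).trans (Coco.char_mul hB h _ _)
    · ext x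
      simpa using LinearMap.congr_fun h0 (φl.symm x)
  choose f hf using hex
  have hinj : Function.Injective f := fun h h' hh ↦ by
    refine Coco.char_injective hB (LinearMap.ext fun x ↦ ?_)
    have h1 := hf h
    rw [hh, hf h'] at h1
    simpa using (LinearMap.congr_fun h1 (φl.symm x)).symm
  have hsurj : Function.Surjective f := fun g ↦ by
    obtain ⟨h, hh⟩ := Coco.exists_char_eq K hB (ψ := Coco.char K hA g ∘ₗ φl.symm.toLinearMap)
      (fun x y ↦ (congrArg _ (hφs x y)).trans (Coco.char_mul hA g _ _))
      fun h0 ↦ Coco.char_ne_zero hA g (LinearMap.ext fun x ↦ by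
        simpa using LinearMap.congr_fun h0 (φl x))
    refine ⟨h, Coco.char_injective hA ?_⟩
    rw [hf, hh]
    ext x
    simp
  have hadd (h h') : f (h + h') = f h + f h' := by
    refine Coco.char_injective hA (LinearMap.ext fun x ↦ ?_)
    rw [hf, ← Coco.tmulFun_comul, hf, hf, LinearMap.comp_apply, ← Coco.tmulFun_comul,
      ← tmulFun_map]
    exact congrArg _ (CoalgHomClass.map_comp_comul_apply φ x).symm
  exact ⟨(AddEquiv.ofBijective (⟨f, hadd⟩ : AddHom _ _) ⟨hinj, hsurj⟩).symm⟩

end Reconstruction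

end Isomorphism

end Qurve

/-! ### The main theorem -/

theorem mainTheorem12 {ℓ : Type u} [Field ℓ] {A : Type v} [Ring A] [Algebra ℓ A]
    (hA : Qurve.IsQurve ℓ A) :
    -- the constituents of `coco(A)` and of the function bialgebra are well-defined
    (∀ n, IsGreatest {S : Subalgebra ℓ (Qurve.RepRing ℓ A n) | Qurve.IsUnramified ℓ S}
      (Qurve.piRep ℓ A n)) ∧
    (∀ (m n N : ℕ) (h : m + n = N), Function.Injective (Qurve.piRepIncl ℓ A m n) ∧
      ∀ x : Qurve.piRep ℓ A N,
        Qurve.piRepIncl ℓ A m n (Qurve.piRepComul ℓ A h x) = Qurve.sumComap ℓ A h x) ∧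
    (∀ γ : Qurve.Comp (AlgebraicClosure ℓ) (AlgebraicClosure ℓ ⊗[ℓ] A),
      {p : Qurve.Comp (AlgebraicClosure ℓ) (AlgebraicClosure ℓ ⊗[ℓ] A) ×
        Qurve.Comp (AlgebraicClosure ℓ) (AlgebraicClosure ℓ ⊗[ℓ] A) | p.1 + p.2 = γ}.Finite) ∧
    -- both are mock bialgebras
    Qurve.IsMockBialgebra ℓ (Qurve.Coco ℓ A) ∧
    Qurve.IsMockBialgebra (AlgebraicClosure ℓ) (Qurve.Func (AlgebraicClosure ℓ)
      (Qurve.Comp (AlgebraicClosure ℓ) (AlgebraicClosure ℓ ⊗[ℓ] A))) ∧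
    -- the isomorphism of mock bialgebras, and Galois descent
    (∃ e : (AlgebraicClosure ℓ ⊗[ℓ] Qurve.Coco ℓ A) ≃ₗc[AlgebraicClosure ℓ]
        Qurve.Func (AlgebraicClosure ℓ)
          (Qurve.Comp (AlgebraicClosure ℓ) (AlgebraicClosure ℓ ⊗[ℓ] A)),
      (∀ x y, e (x * y) = e x * e y) ∧
      Set.range (fun c : Qurve.Coco ℓ A ↦ e (1 ⊗ₜ[ℓ] c)) =
        {f | (∀ σ : AlgebraicClosure ℓ ≃ₐ[ℓ] AlgebraicClosure ℓ, Qurve.Func.gal σ f = f) ∧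
          ∀ α, IsSeparable ℓ (f α)} ∧
      (PerfectField ℓ → Set.range (fun c : Qurve.Coco ℓ A ↦ e (1 ⊗ₜ[ℓ] c)) =
        {f | ∀ σ : AlgebraicClosure ℓ ≃ₐ[ℓ] AlgebraicClosure ℓ, Qurve.Func.gal σ f = f})) ∧
    -- `coco(A)` determines the component semigroup
    (∀ (B : Type v) [Ring B] [Algebra ℓ B], Qurve.IsQurve ℓ B →
      ∀ φ : Qurve.Coco ℓ A ≃ₗc[ℓ] Qurve.Coco ℓ B, (∀ x y, φ (x * y) = φ x * φ y) →
        Nonempty (Qurve.Comp (AlgebraicClosure ℓ) (AlgebraicClosure ℓ ⊗[ℓ] A) ≃+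
          Qurve.Comp (AlgebraicClosure ℓ) (AlgebraicClosure ℓ ⊗[ℓ] B))) := by
  have hrange := Qurve.Coco.range_toFunc_one_tmul (K := AlgebraicClosure ℓ) hA
  refine ⟨hA.isGreatest_piRep,
    fun m n N h ↦ ⟨Qurve.piRepIncl_injective ℓ A m n, hA.piRepIncl_piRepComul h⟩,
    hA.finite_add_eq, hA.isMockBialgebra_coco, Qurve.Func.isMockBialgebra hA.finite_add_eq,
    ⟨Qurve.Coco.funcEquiv hA, Qurve.Coco.toFunc_mul hA, hrange, fun _ ↦ hrange.trans ?_⟩,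
    fun B _ _ hB φ hφ ↦ hA.nonempty_comp_addEquiv (AlgebraicClosure ℓ) hB φ hφ⟩
  ext f
  -- Over a perfect field every algebraic element is separable, so that condition is vacuous.
  exact and_iff_left fun α ↦ Algebra.IsSeparable.isSeparable ℓ (f α)
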